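/- Fix an integer $n\ge 1$. Let $X_1,\dots,X_n$ be i.i.d. nonnegative random variables with distribution function $F$, and let $M_n(F)=\mathbb E\max_{1\le t\le n}X_t$. For $\theta\in[0,\infty]$ and $p\in[0,1]$ let $\tau_p(\theta)$ be the randomized single threshold rule which stops at the first $t\le n-1$ such that $X_t>\theta$, or $X_t=\theta$ and $\xi_t=1$, and stops at $n$ if there is no such $t$; here $\xi_1,\dots,\xi_n$ are i.i.d. Bernoulli($p$) variables independent of the $X_t$. Put $$V_n(\tau;F)=\mathbb E X_\tau,\qquad \mathcal R_n(\tau;F)=\frac{V_n(\tau;F)}{M_n(F)},\qquad \mathcal A_n(\tau;F)=M_n(F)-V_n(\tau;F),$$ and let $\mathcal T=\{\tau_p(\theta):0\le\theta<\infty,\ 0\le p\le 1\}$. Let $\mathcal F_{[0,\infty)}$ be the class of all distributions on $[0,\infty)$ with finite mean other than the point mass at $0$, and $\mathcal F_{[0,1]}$ the class of all distributions on $[0,1]$. The decision maker, who knows $F$, may parametrize single threshold rules by a quantile level $x\in[0,1]$: let $\tau_x=\tau_{p_x}(\theta_x)$ with $\theta_x=F^{\leftarrow}(x)=\inf\{z\in[0,\infty):F(z)\ge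 x\}\in[0,\infty]$, and $p_x=\frac{F(\theta_x)-x}{F(\theta_x)-F(\theta_x-)}$ if $F(\theta_x)>x$, $p_x=0$ if $F(\theta_x)=x$ (with $F(\infty)=1$). Thus $x$ is the probability that a single observation is rejected. A mixed strategy $\lambda$, a probability distribution on $[0,1]$, draws the level $x$ at random from $\lambda$, and $\mathcal R_n(\lambda;F)=\int\mathcal R_n(\tau_x;F)\,d\lambda(x)$, $\mathcal A_n(\lambda;F)=\int\mathcal A_n(\tau_x;F)\,d\lambda(x)$. For $x,y\in[0,1]$ let $$R(x,y)=\begin{cases}\dfrac{1-x^{n-1}y}{1-y^n},&x>y,\\[2mm] \dfrac{1+x+\dots+x^{n-1}}{1+y+\dots+y^{n-1}},&x<y,\\[2mm] 1,&x=y,\end{cases}\qquad A(x,y)=\begin{cases}y\,(x^{n-1}-y^{n-1}),&x>y,\\[1mm] (1-y)\sum_{k=1}^{n-1}(y^k-x^k),&x\le y,\end{cases}$$ and, for probability distributions $\lambda,\mu$ on $[0,1]$, $\bar R(\lambda,\mu)=\iint R\,d\lambda(x)\,d\mu(y)$ and $\bar A(\lambda,\mu)=\iint A\,d\lambda(x)\,d\mu(y)$.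 Then both infinite games have solutions, and minimization and maximization can be interchanged: 1. (Ratio.) There is a real number $v$ such that the game $\bar R$ has a saddle point with value $v$, i.e. there are $\lambda_0,\mu_0$ with $\bar R(\lambda,\mu_0)\le v=\bar R(\lambda_0,\mu_0)\le\bar R(\lambda_0,\mu)$ for all $\lambda,\mu$, and $$v=\inf_\mu\sup_\lambda\bar R(\lambda,\mu)=\sup_\lambda\inf_\mu\bar R(\lambda,\mu)=\inf_{F\in\mathcal F_{[0,\infty)}}\sup_{\tau\in\mathcal T}\mathcal R_n(\tau;F)$$ $$=\inf_{F\in\mathcal F_{[0,\infty)}}\sup_{x\in[0,1]}\mathcal R_n(\tau_x;F)=\sup_{x\in[0,1]}\inf_{F\in\mathcal F_{[0,\infty)}}\mathcal R_n(\tau_x;F)=\inf_{F\in\mathcal F_{[0,\infty)}}\sup_\lambda\mathcal R_n(\lambda;F)=\sup_\lambda\inf_{F\in\mathcal F_{[0,\infty)}}\mathcal R_n(\lambda;F).$$ 2. (Regret.) There is a real number $w$ such that the game $\bar A$ has a saddle point with value $w$, i.e. there are $\lambda_0,\mu_0$ with $\bar A(\lambda_0,\mu)\le w=\bar A(\lambda_0,\mu_0)\le\bar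 A(\lambda,\mu_0)$ for all $\lambda,\mu$, and $$w=\sup_\mu\inf_\lambda\bar A(\lambda,\mu)=\inf_\lambda\sup_\mu\bar A(\lambda,\mu)=\sup_{F\in\mathcal F_{[0,1]}}\inf_{\tau\in\mathcal T}\mathcal A_n(\tau;F)$$ $$=\sup_{F\in\mathcal F_{[0,1]}}\inf_{x\in[0,1]}\mathcal A_n(\tau_x;F)=\inf_{x\in[0,1]}\sup_{F\in\mathcal F_{[0,1]}}\mathcal A_n(\tau_x;F)=\sup_{F\in\mathcal F_{[0,1]}}\inf_\lambda\mathcal A_n(\lambda;F)=\inf_\lambda\sup_{F\in\mathcal F_{[0,1]}}\mathcal A_n(\lambda;F).$$ -/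

import Mathlib

open MeasureTheory ProbabilityTheory Set unitInterval
open scoped NNReal ENNReal

noncomputable section

namespace ProphetGame

/-! ### Distributions on the half-line

A distribution on `[0, ∞)` is a `ProbabilityMeasure ℝ≥0`. -/

/-- Distributions on `[0, ∞)` with finite mean, other than the point mass at `0`
(for which the competitive ratio is not defined). -/
def distNonneg : Set (ProbabilityMeasure ℝ≥0) :=
  {F | Integrable (fun x : ℝ≥0 => (x : ℝ)) (F : Measure ℝ≥0) ∧
    ¬ ∀ᵐ x ∂(F : Measure ℝ≥0), x = 0}

/-- Distributions on `[0, 1]`. -/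
def distUnit : Set (ProbabilityMeasure ℝ≥0) :=
  {F | ∀ᵐ x ∂(F : Measure ℝ≥0), x ≤ 1}

/-- The distribution function `F(θ)`, with `F(∞) = 1`. -/
def cdfAt (F : ProbabilityMeasure ℝ≥0) (θ : ℝ≥0∞) : ℝ :=
  (F : Measure ℝ≥0).real {z | (z : ℝ≥0∞) ≤ θ}

/-- The left limit `F(θ-)`. -/
def cdfLeft (F : ProbabilityMeasure ℝ≥0) (θ : ℝ≥0∞) : ℝ :=
  (F : Measure ℝ≥0).real {z | (z : ℝ≥0∞) < θ}

/-- The quantile function `F^←(x) = inf {z ∈ [0, ∞) : F(z) ≥ x} ∈ [0, ∞]`. -/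
def quantile (F : ProbabilityMeasure ℝ≥0) (x : ℝ) : ℝ≥0∞ :=
  sInf {θ | ∃ z : ℝ≥0, θ = z ∧ x ≤ cdfAt F z}

/-! ### Randomized single threshold rules -/

/-- The rule `τ_p(θ)`: accept an observation if it exceeds the threshold `θ`, or if it equals `θ`
and an independent coin with success probability `p` shows success. An infinite threshold means
that nothing is accepted before the last time. -/
structure ThresholdRule where
  /-- the threshold -/
  θ : ℝ≥0∞
  /-- the success probability of the coin -/
  p : I

/-- The class of all rules `τ_p(θ)` with `θ ∈ [0, ∞)` and `p ∈ [0, 1]`. -/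
def finiteRules : Set ThresholdRule := {τ | τ.θ ≠ ∞}

/-- An observation `ω.1` together with its coin `ω.2` is accepted. -/
def ThresholdRule.Accepts (τ : ThresholdRule) (ω : ℝ≥0 × Bool) : Prop :=
  τ.θ < (ω.1 : ℝ≥0∞) ∨ ((ω.1 : ℝ≥0∞) = τ.θ ∧ ω.2 = true)

open Classical in
/-- The stopping time: the first time before the last one at which the observation is accepted, and
the last time if there is none. The times `1, …, n` are the elements of `Fin n`, and `⊤` is the
last time. -/
def ThresholdRule.time (τ : ThresholdRule) {n : ℕ} [NeZero n] (ω : Fin n → ℝ≥0 × Bool) : Fin n :=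
  (Finset.univ.filter fun t => τ.Accepts (ω t) ∨ t = ⊤).min' ⟨⊤, by simp⟩

/-- The law of `n` independent observations with distribution `F` and `n` independent coins with
success probability `p`, the coins being independent of the observations. -/
def sampleLaw (n : ℕ) (F : ProbabilityMeasure ℝ≥0) (p : I) : Measure (Fin n → ℝ≥0 × Bool) :=
  Measure.pi fun _ => (F : Measure ℝ≥0).prod (bernoulliMeasure true false p)

/-- The reward `V_n(τ; F) = E X_τ`. -/
def reward (n : ℕ) [NeZero n] (τ : ThresholdRule) (F : ProbabilityMeasure ℝ≥0) : ℝ :=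
  ∫ ω, ((ω (τ.time ω)).1 : ℝ) ∂(sampleLaw n F τ.p)

/-- The performance of the prophet, `M_n(F) = E max (X_1, …, X_n)`. -/
def prophet (n : ℕ) (F : ProbabilityMeasure ℝ≥0) : ℝ :=
  ∫ X : Fin n → ℝ≥0, ((Finset.univ.sup X : ℝ≥0) : ℝ) ∂(Measure.pi fun _ => (F : Measure ℝ≥0))

/-- The competitive ratio `V_n(τ; F) / M_n(F)`. -/
def ratio (n : ℕ) [NeZero n] (τ : ThresholdRule) (F : ProbabilityMeasure ℝ≥0) : ℝ :=
  reward n τ F / prophet n F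

/-- The regret `M_n(F) - V_n(τ; F)`. -/
def regret (n : ℕ) [NeZero n] (τ : ThresholdRule) (F : ProbabilityMeasure ℝ≥0) : ℝ :=
  prophet n F - reward n τ F

/-! ### Rules given by a quantile level -/

/-- The success probability `p_x = (F(θ_x) - x) / (F(θ_x) - F(θ_x-))`, where `θ_x = F^←(x)`. It is
`0` if `F(θ_x) = x`. -/
def levelProb (F : ProbabilityMeasure ℝ≥0) (x : ℝ) : ℝ :=
  (cdfAt F (quantile F x) - x) / (cdfAt F (quantile F x) - cdfLeft F (quantile F x))

lemma le_cdfAt_quantile (F : ProbabilityMeasure ℝ≥0) (x : I) :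
    (x : ℝ) ≤ cdfAt F (quantile F x) := by
  by_cases hq : quantile F x = ∞
  · have h : cdfAt F ∞ = 1 := by simp [cdfAt]
    rw [hq, h]
    exact x.2.2
  · -- right continuity of the distribution function
    lift quantile F x to ℝ≥0 using hq with q hq'
    have key : ∀ k : ℕ, (x : ℝ) ≤ (F : Measure ℝ≥0).real (Iic (q + 1 / ((k : ℝ≥0) + 1))) := by
      intro k
      have hlt : quantile F x < ((q + 1 / ((k : ℝ≥0) + 1) : ℝ≥0) : ℝ≥0∞) := by
        rw [← hq', ENNReal.coe_lt_coe]
        exact lt_add_of_pos_right q (by positivity)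
      obtain ⟨θ, ⟨z, rfl, hz⟩, hzlt⟩ := sInf_lt_iff.mp hlt
      refine hz.trans (measureReal_mono fun w hw => ?_)
      exact (ENNReal.coe_le_coe.mp hw).trans (ENNReal.coe_lt_coe.mp hzlt).le
    have hlim : Filter.Tendsto
        (fun k : ℕ => (F : Measure ℝ≥0) (Iic (q + 1 / ((k : ℝ≥0) + 1)))) Filter.atTop
        (nhds ((F : Measure ℝ≥0) (⋂ k : ℕ, Iic (q + 1 / ((k : ℝ≥0) + 1))))) := by
      refine tendsto_measure_iInter_atTop (fun k => measurableSet_Iic.nullMeasurableSet) ?_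
        ⟨0, measure_ne_top _ _⟩
      intro i j hij
      refine Iic_subset_Iic.mpr (add_le_add le_rfl ?_)
      exact one_div_le_one_div_of_le (by positivity) (by gcongr)
    have hset : (⋂ k : ℕ, Iic (q + 1 / ((k : ℝ≥0) + 1))) = {z : ℝ≥0 | (z : ℝ≥0∞) ≤ (q : ℝ≥0∞)} := by
      ext z
      simp only [mem_iInter, mem_Iic, mem_ofPred_eq, ENNReal.coe_le_coe]
      refine ⟨fun h => ?_, fun h k => h.trans (le_add_of_nonneg_right (by positivity))⟩
      have h0 : Filter.Tendsto (fun k : ℕ => q + 1 / ((k : ℝ≥0) + 1)) Filter.atTop (nhds (q + 0)) :=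
        tendsto_const_nhds.add tendsto_one_div_add_atTop_nhds_zero_nat
      rw [add_zero] at h0
      exact ge_of_tendsto' h0 h
    have hlim' := (ENNReal.tendsto_toReal (measure_ne_top (F : Measure ℝ≥0) _)).comp hlim
    rw [hset] at hlim'
    exact ge_of_tendsto' hlim' key

lemma cdfLeft_quantile_le (F : ProbabilityMeasure ℝ≥0) (x : I) :
    cdfLeft F (quantile F x) ≤ x := by
  -- a set of the form `{z < θ}` is exhausted by sets of the form `{z ≤ u}` with `u < θ`
  by_contra! hlt
  have hpos : (ENNReal.ofReal x) < (F : Measure ℝ≥0) {z | (z : ℝ≥0∞) < quantile F x} :=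
    (ENNReal.ofReal_lt_iff_lt_toReal x.2.1 (measure_ne_top _ _)).mpr hlt
  have hopen : IsOpen {z : ℝ≥0 | (z : ℝ≥0∞) < quantile F x} :=
    isOpen_Iio.preimage ENNReal.continuous_coe
  obtain ⟨K, hKsub, hK, hKlt⟩ := hopen.exists_lt_isCompact hpos
  have hne : K.Nonempty := by
    rw [nonempty_iff_ne_empty]
    rintro rfl
    simp at hKlt
  obtain ⟨u, huK, hu⟩ := hK.exists_isGreatest hne
  have hxu : (x : ℝ) ≤ cdfAt F u := by
    have h1 : (x : ℝ) < (F : Measure ℝ≥0).real K :=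
      (ENNReal.ofReal_lt_iff_lt_toReal x.2.1 (measure_ne_top _ _)).mp hKlt
    exact h1.le.trans (measureReal_mono fun w hw => ENNReal.coe_le_coe.mpr (hu hw))
  have hle : quantile F x ≤ (u : ℝ≥0∞) := sInf_le ⟨u, rfl, hxu⟩
  exact absurd hle (not_le.mpr (hKsub huK))

lemma levelProb_mem (F : ProbabilityMeasure ℝ≥0) (x : I) : levelProb F x ∈ I := by
  have h1 := le_cdfAt_quantile F x
  have h2 := cdfLeft_quantile_le F x
  refine ⟨div_nonneg (by linarith) (by linarith), div_le_one_of_le₀ (by linarith) (by linarith)⟩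

/-- The rule with quantile level `x ∈ [0, 1]`: under `F` it has threshold `θ_x = F^←(x)` and success
probability `p_x`, so that a single observation is rejected with probability exactly `x`. -/
def levelRule (x : I) (F : ProbabilityMeasure ℝ≥0) : ThresholdRule :=
  ⟨quantile F x, ⟨levelProb F x, levelProb_mem F x⟩⟩

/-- The ratio of the mixed strategy which draws the level `x` from `lam`. -/
def mixedRatio (n : ℕ) [NeZero n] (lam : ProbabilityMeasure I) (F : ProbabilityMeasure ℝ≥0) : ℝ :=
  ∫ x, ratio n (levelRule x F) F ∂(lam : Measure I)

/-- The regret of the mixed strategy which draws the level `x` from `lam`. -/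
def mixedRegret (n : ℕ) [NeZero n] (lam : ProbabilityMeasure I) (F : ProbabilityMeasure ℝ≥0) : ℝ :=
  ∫ x, regret n (levelRule x F) F ∂(lam : Measure I)

/-! ### The games on the unit square -/

/-- The kernel `R(x, y)`. For `x < y` the quotient `(1 - y) / (1 - y ^ n) * ((1 - x ^ n) / (1 - x))`
is written with geometric sums, which gives it its continuous value at `y = 1`. -/
def kernelR (n : ℕ) (x y : ℝ) : ℝ :=
  if y < x then (1 - x ^ (n - 1) * y) / (1 - y ^ n)
  else if x < y then (∑ k ∈ Finset.range n, x ^ k) / (∑ k ∈ Finset.range n, y ^ k)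
  else 1

/-- The kernel `A(x, y)`. -/
def kernelA (n : ℕ) (x y : ℝ) : ℝ :=
  if y < x then y * (x ^ (n - 1) - y ^ (n - 1))
  else (1 - y) * ∑ k ∈ Finset.Icc 1 (n - 1), (y ^ k - x ^ k)

/-- The expected pay-off in the ratio game. -/
def payoffR (n : ℕ) (lam mu : ProbabilityMeasure I) : ℝ :=
  ∫ y, ∫ x, kernelR n x y ∂(lam : Measure I) ∂(mu : Measure I)

/-- The expected pay-off in the regret game. -/
def payoffA (n : ℕ) (lam mu : ProbabilityMeasure I) : ℝ :=
  ∫ y, ∫ x, kernelA n x y ∂(lam : Measure I) ∂(mu : Measure I)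

end ProphetGame

end

noncomputable section

namespace ProphetGame

/-! ### Inequalities for powers -/

/-! Tail integrals reduce the stopping problem to the two games on the square. The events of
exceeding a height `s` and of being accepted are nested, so a threshold rule enters its reward only
through its rejection probability `x`: the reward is the integral over `s > 0` of `levelReward n x
(F(s))`, and the prophet gets the integral of `1 - F(s) ^ n` (`reward_eq_integral`,
`prophet_eq_integral`). Since `levelReward n x y = R(x, y) * (1 - y ^ n)` and `1 - y ^ n -
levelReward n x y = A(x, y)`, the ratio is an average of `R(x, F(s))` with weight `1 - F(s) ^ n`,
and the regret is the integral of `A(x, F(s))`. A distribution thus acts as a mixed strategy of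
nature over the levels `y = F(s)`, and a three-point distribution realizes a mixture of two levels.

Both games are solved explicitly, by one pure level `x₀` against a mixture of two levels
(`exists_ratio_solution`, `exists_regret_solution`). The intermediate value theorem gives an `x₀`
for which the worst `y` below `x₀` and the worst `y` above it are equally bad. For `m = n - 1`, the
kernel at the lower level is affine in `x ^ m` to the right of that level, while at the upper level
it depends on `1 + x + ⋯ + x ^ m`, which is concave in `x ^ m` and so lies below its tangent at
`x₀`. Mixing weights that cancel the two slopes make `x₀` a best reply.

The pure level `x₀` and the approximate or exact worst distribution then sandwich all the values, so
no general minimax theorem is needed. In the ratio game the upper level is `1`, which carries weight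
`0` in every distribution; it is approached by levels `y₁ < 1`. In the regret game the mixture is
realized exactly. -/

lemma mul_pow_sub_one_le {r : ℝ} (hr : 0 ≤ r) {k m : ℕ} (hkm : k ≤ m) :
    (m : ℝ) * (r ^ k - 1) ≤ k * (r ^ m - 1) := by
  induction m, hkm using Nat.le_induction with
  | base => exact le_rfl
  | succ m hkm ih =>
    -- The terms `r ^ j * (r - 1)` increase with `j` on either side of `r = 1`, so the step from `m`
    -- to `m + 1` dominates each of the `k` terms whose sum telescopes to `r ^ k - 1`.
    have hterm : ∀ j ∈ Finset.range k, r ^ j * (r - 1) ≤ r ^ m * (r - 1) := by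
      intro j hj
      have hjm : j ≤ m := (Finset.mem_range.mp hj).le.trans hkm
      rcases le_total r 1 with h | h
      · exact mul_le_mul_of_nonpos_right (pow_le_pow_of_le_one hr h hjm) (by linarith)
      · exact mul_le_mul_of_nonneg_right (pow_le_pow_right₀ h hjm) (by linarith)
    have hsum := Finset.sum_le_sum hterm
    rw [← Finset.sum_mul, geom_sum_mul, Finset.sum_const, Finset.card_range, nsmul_eq_mul] at hsum
    push_cast
    rw [pow_succ]
    linarith

/-- In the variable `u = x ^ m` each summand `x ^ k = u ^ (k / m)` is concave, so the sum lies below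
its tangent at `u = x₀ ^ m`. The constant `C` is the slope of that tangent. It makes the kernels at
nature's two levels comparable as functions of `x ^ m`. -/
lemma exists_sum_pow_sub_pow_le {x₀ : ℝ} (hx₀ : 0 < x₀) (m : ℕ) (hm : 1 ≤ m) :
    ∃ C : ℝ, 0 < C ∧ ∀ x, 0 ≤ x →
      ∑ k ∈ Finset.range (m + 1), (x ^ k - x₀ ^ k) ≤ C * (x ^ m - x₀ ^ m) := by
  have hm0 : (0 : ℝ) < m := by exact_mod_cast hm
  refine ⟨∑ k ∈ Finset.range (m + 1), (k / m * (x₀ ^ k / x₀ ^ m) : ℝ), ?_, fun x hx => ?_⟩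
  · rw [Finset.sum_range_succ]
    refine add_pos_of_nonneg_of_pos (Finset.sum_nonneg fun k _ => by positivity) (by positivity)
  · rw [Finset.sum_mul]
    refine Finset.sum_le_sum fun k hk => ?_
    have h := mul_pow_sub_one_le (div_nonneg hx hx₀.le) (Nat.lt_succ_iff.mp (Finset.mem_range.mp hk))
    have e1 : x ^ k - x₀ ^ k = x₀ ^ k / m * (m * ((x / x₀) ^ k - 1)) := by
      rw [div_pow]; field_simp
    have e2 : k / m * (x₀ ^ k / x₀ ^ m) * (x ^ m - x₀ ^ m)
        = x₀ ^ k / m * (k * ((x / x₀) ^ m - 1)) := by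
      rw [div_pow]; field_simp
    rw [e1, e2]
    exact mul_le_mul_of_nonneg_left h (by positivity)

lemma geom_sum_pos_of_nonneg {n : ℕ} (hn : n ≠ 0) {x : ℝ} (hx : 0 ≤ x) :
    0 < ∑ k ∈ Finset.range n, x ^ k :=
  Finset.sum_pos' (fun _ _ => pow_nonneg hx _)
    ⟨0, Finset.mem_range.mpr (Nat.pos_of_ne_zero hn), by simp⟩

lemma geom_sum_mono {n : ℕ} {x y : ℝ} (hx : 0 ≤ x) (hxy : x ≤ y) :
    ∑ k ∈ Finset.range n, x ^ k ≤ ∑ k ∈ Finset.range n, y ^ k :=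
  Finset.sum_le_sum fun _ _ => pow_le_pow_left₀ hx hxy _

lemma geom_sum_le {n : ℕ} {x : ℝ} (hx : 0 ≤ x) (hx1 : x ≤ 1) :
    ∑ k ∈ Finset.range n, x ^ k ≤ n := by
  simpa using geom_sum_mono (n := n) hx hx1

lemma geom_sum_mul_one_sub (n : ℕ) (x : ℝ) :
    (∑ k ∈ Finset.range n, x ^ k) * (1 - x) = 1 - x ^ n := by
  linarith [geom_sum_mul x n]

/-! ### The ratio game -/

/-- A pure level for the decision maker and a two-point mixture for nature solve the
ratio game. -/
lemma exists_ratio_solution (n : ℕ) [NeZero n] :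
    ∃ x₀ y₀ p v : ℝ, 0 ≤ x₀ ∧ x₀ < 1 ∧ 0 ≤ y₀ ∧ y₀ < 1 ∧ 0 ≤ p ∧ p ≤ 1 ∧ 0 ≤ v ∧
      (∀ y, 0 ≤ y → y ≤ 1 → v ≤ kernelR n x₀ y) ∧
      (∀ x, 0 ≤ x → x ≤ 1 → p * kernelR n x y₀ + (1 - p) * kernelR n x 1 ≤ v) := by
  obtain ⟨m, rfl⟩ : ∃ m, n = m + 1 := ⟨n - 1, by have := NeZero.ne n; omega⟩
  rcases Nat.eq_zero_or_pos m with rfl | hm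
  · refine ⟨0, 0, 1, 1, le_rfl, one_pos, le_rfl, one_pos, zero_le_one, le_rfl, zero_le_one,
      fun y hy hy1 => ?_, fun x hx hx1 => ?_⟩
    · have : ¬ y < 0 := not_lt.mpr hy
      simp [kernelR, this]
    · rcases hx.eq_or_lt with rfl | h
      · simp [kernelR]
      · simp [kernelR, h]
  -- `h x y ≥ 0` says that level `x` guarantees the ratio `S x / (m + 1)` against `y`
  set S : ℝ → ℝ := fun x => ∑ k ∈ Finset.range (m + 1), x ^ k with hS
  set h : ℝ → ℝ → ℝ := fun x y => 1 - x ^ m * y - S x / (m + 1) * (1 - y ^ (m + 1)) with hh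
  have hScont : Continuous S := by fun_prop
  have hcont : Continuous (fun q : ℝ × ℝ => h q.1 q.2) := by
    simp only [hh]; fun_prop
  have hK : IsCompact (Icc (0 : ℝ) 1) := isCompact_Icc
  have hKne : (Icc (0 : ℝ) 1).Nonempty := ⟨0, by simp⟩
  have hmin := fun x => hK.exists_sInf_image_eq_and_le hKne
    (f := h x) (hcont.comp (Continuous.prodMk_right x)).continuousOn
  set M : ℝ → ℝ := fun x => sInf (h x '' Icc 0 1) with hM
  have hMcont : Continuous M := hK.continuous_sInf (f := h) hcont
  have hS0 : S 0 = 1 := by simp [hS, Finset.sum_range_succ']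
  have hm1 : (0 : ℝ) < m + 1 := by positivity
  have hm0 : (1 : ℝ) ≤ m := by exact_mod_cast hm
  have hM0 : 0 ≤ M 0 := by
    obtain ⟨y, hy, hMy, -⟩ := hmin 0
    rw [show M 0 = h 0 y from hMy]
    simp only [hh, hS0]
    rw [zero_pow hm.ne', zero_mul]
    have h1 : y ^ (m + 1) ≤ 1 := pow_le_one₀ hy.1 hy.2
    have h2 : 0 ≤ y ^ (m + 1) := pow_nonneg hy.1 _
    have h3 : 1 / (m + 1 : ℝ) ≤ 1 := by rw [div_le_one hm1]; linarith
    have h4 : 0 ≤ 1 / (m + 1 : ℝ) := by positivity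
    nlinarith
  have hS1 : S 1 / (m + 1) = 1 := by
    simp [hS, hm1.ne']
  have hM1 : M 1 < 0 := by
    obtain ⟨y, hy, hMy, hle⟩ := hmin 1
    have := hle (1 / 2) (by constructor <;> norm_num)
    refine (hMy.trans_le this).trans_lt ?_
    simp only [hh, hS1]
    have : ((1 : ℝ) / 2) ^ (m + 1) < 1 / 2 := by
      rw [pow_succ]
      have := pow_lt_one₀ (by norm_num : (0 : ℝ) ≤ 1 / 2) (by norm_num) hm.ne'
      linarith
    rw [one_pow]; linarith
  -- At this `x₀` the ratio `S x₀ / (m + 1)`, which is what `x₀` obtains against `y = 1`, is also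
  -- just barely guaranteed against the lower levels; `y₀` is a level where this is tight.
  obtain ⟨x₀, hx₀, hMx₀⟩ := intermediate_value_Icc' zero_le_one hMcont.continuousOn ⟨hM1.le, hM0⟩
  obtain ⟨y₀, hy₀, hMy₀, hle⟩ := hmin x₀
  have hzero : h x₀ y₀ = 0 := hMy₀.symm.trans hMx₀
  have hnonneg : ∀ y, 0 ≤ y → y ≤ 1 → 0 ≤ h x₀ y := fun y h0 h1 => hzero.symm.trans_le (hle y ⟨h0, h1⟩)
  have hx1 : x₀ < 1 := by
    refine lt_of_le_of_ne hx₀.2 fun e => ?_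
    rw [e] at hMx₀; linarith
  have hy1 : y₀ < 1 := by
    refine lt_of_le_of_ne hy₀.2 fun e => ?_
    have h1 : x₀ ^ m < 1 := pow_lt_one₀ hx₀.1 hx1 hm.ne'
    rw [e] at hzero
    simp only [hh, one_pow] at hzero
    linarith
  have hSpos : ∀ x, 0 ≤ x → 0 < S x := fun x hx => geom_sum_pos_of_nonneg (Nat.succ_ne_zero m) hx
  have hSmono : ∀ x y, 0 ≤ x → x ≤ y → S x ≤ S y := fun x y hx hxy => geom_sum_mono hx hxy
  have hSle : ∀ x, 0 ≤ x → x ≤ 1 → S x ≤ m + 1 := fun x hx hx1 => by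
    simpa [hS] using geom_sum_le (n := m + 1) hx hx1
  set v : ℝ := S x₀ / (m + 1) with hv
  have hv0 : 0 ≤ v := div_nonneg (hSpos _ hx₀.1).le hm1.le
  have hv1 : v < 1 := by
    rw [hv, div_lt_one hm1]
    have : S x₀ < ∑ k ∈ Finset.range (m + 1), (1 : ℝ) := by
      refine Finset.sum_lt_sum (fun k _ => pow_le_one₀ hx₀.1 hx1.le) ⟨1, by simp; omega, by simpa⟩
    simpa using this
  -- For `x₀ ≤ y < 1` one has `h x₀ y ≥ (1 - v) * (1 - y ^ (m + 1)) > 0`, so the zero `y₀` lies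
  -- where the first branch of `kernelR` applies.
  have hyx : y₀ < x₀ := by
    by_contra! hle
    have h1 : x₀ ^ m ≤ y₀ ^ m := pow_le_pow_left₀ hx₀.1 hle _
    have h2 : y₀ ^ (m + 1) < 1 := pow_lt_one₀ hy₀.1 hy1 (Nat.succ_ne_zero m)
    have h3 : x₀ ^ m * y₀ ≤ y₀ ^ (m + 1) := by
      rw [pow_succ]; exact mul_le_mul_of_nonneg_right h1 hy₀.1
    have h4 : 1 - x₀ ^ m * y₀ - v * (1 - y₀ ^ (m + 1)) = 0 := hzero
    nlinarith
  have hxpos : 0 < x₀ := hy₀.1.trans_lt hyx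
  obtain ⟨C, hC, hCle⟩ := exists_sum_pow_sub_pow_le hxpos m hm
  have hD : 0 < 1 - y₀ ^ (m + 1) := by
    linarith [pow_lt_one₀ hy₀.1 hy1 m.add_one_ne_zero]
  set a : ℝ := y₀ / (1 - y₀ ^ (m + 1)) with ha
  have ha0 : 0 ≤ a := div_nonneg hy₀.1 hD.le
  have hq : 0 < a + C / (m + 1) := by positivity
  have hR1 : ∀ x, 0 ≤ x → x ≤ 1 → kernelR (m + 1) x 1 = S x / (m + 1) := by
    intro x hx hx1
    rcases hx1.eq_or_lt with rfl | hlt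
    · rw [hS1]; simp [kernelR]
    · simp [kernelR, hlt, hlt.not_gt, hS]
  have hRge : ∀ x, y₀ ≤ x → kernelR (m + 1) x y₀ = (1 - x ^ m * y₀) / (1 - y₀ ^ (m + 1)) := by
    intro x hx
    rcases hx.eq_or_lt with rfl | hlt
    · simp only [kernelR, lt_irrefl, if_false]
      rw [← pow_succ, div_self hD.ne']
    · simp [kernelR, hlt]
  have hRx₀ : (1 - x₀ ^ m * y₀) / (1 - y₀ ^ (m + 1)) = v := by
    rw [div_eq_iff hD.ne']
    exact sub_eq_zero.mp hzero
  -- For `x ≥ y₀`, `R(x, y₀)` is affine in `x ^ m` with slope `-a`, and `R(x, 1)` lies below a line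
  -- of slope `C / (m + 1)`; both lines have height `v` at `x₀`. This weight cancels the slopes.
  set p : ℝ := C / (m + 1) / (a + C / (m + 1)) with hp
  have hp0 : 0 ≤ p := by positivity
  have hp1 : p ≤ 1 := by rw [hp, div_le_one hq]; linarith
  have hpa : p * a = (1 - p) * (C / (m + 1)) := by
    rw [hp]; field_simp; ring
  have hmix : ∀ x, y₀ ≤ x → x ≤ 1 →
      p * kernelR (m + 1) x y₀ + (1 - p) * kernelR (m + 1) x 1 ≤ v := by
    intro x hx hx1
    rw [hRge x hx, hR1 x (hy₀.1.trans hx) hx1]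
    have h1 := hCle x (hy₀.1.trans hx)
    rw [Finset.sum_sub_distrib] at h1
    change S x - S x₀ ≤ _ at h1
    have h2 : (1 - x ^ m * y₀) / (1 - y₀ ^ (m + 1)) = v + a * (x₀ ^ m - x ^ m) := by
      rw [← hRx₀, ha]; field_simp; ring
    have h3 : S x / (m + 1) ≤ v + C / (m + 1) * (x ^ m - x₀ ^ m) := by
      rw [hv, div_mul_eq_mul_div, ← add_div]
      gcongr; linarith
    have h4 := mul_le_mul_of_nonneg_left h3 (sub_nonneg.mpr hp1)
    rw [h2]
    calc _ ≤ p * (v + a * (x₀ ^ m - x ^ m)) + (1 - p) * (v + C / (m + 1) * (x ^ m - x₀ ^ m)) := by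
          linarith
      _ = v + (p * a - (1 - p) * (C / (m + 1))) * (x₀ ^ m - x ^ m) := by ring
      _ = v := by rw [hpa]; ring
  refine ⟨x₀, y₀, p, v, hx₀.1, hx1, hy₀.1, hy1, hp0, hp1, hv0, fun y hy hy1 => ?_,
    fun x hx hx1 => ?_⟩
  · rcases lt_trichotomy y x₀ with hlt | heq | hgt
    · have hD' : 0 < 1 - y ^ (m + 1) := by
        linarith [pow_lt_one₀ hy (hlt.trans hx1) m.add_one_ne_zero]
      simp only [kernelR, hlt, if_true, Nat.add_sub_cancel]
      rw [le_div_iff₀ hD']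
      have : 0 ≤ 1 - x₀ ^ m * y - v * (1 - y ^ (m + 1)) := hnonneg y hy hy1
      linarith
    · simp [kernelR, heq, hv1.le]
    · simp only [kernelR, hgt, hgt.not_gt, if_true, if_false]
      exact div_le_div_of_nonneg_left (hSpos _ hx₀.1).le (hSpos y hy) (hSle y hy hy1)
  · rcases le_or_gt y₀ x with hge | hlt
    · exact hmix x hge hx1
    -- Below `y₀` both kernels increase with `x`, so `x = y₀` does at least as well.
    · refine le_trans ?_ (hmix y₀ le_rfl hy1.le)
      rw [hR1 x hx hx1, hR1 y₀ hy₀.1 hy1.le]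
      have h1 : kernelR (m + 1) x y₀ ≤ kernelR (m + 1) y₀ y₀ := by
        simp only [kernelR, hlt, hlt.not_gt, lt_irrefl, if_true, if_false]
        exact div_le_one_of_le₀ (hSmono _ _ hx hlt.le) (hSpos _ hy₀.1).le
      have h2 : S x / (m + 1) ≤ S y₀ / (m + 1) := by
        gcongr; exact hSmono _ _ hx hlt.le
      have := mul_le_mul_of_nonneg_left h1 hp0
      have := mul_le_mul_of_nonneg_left h2 (sub_nonneg.mpr hp1)
      linarith

lemma kernelR_nonneg (n : ℕ) {x y : ℝ} (hx : 0 ≤ x) (hx1 : x ≤ 1) (hy : 0 ≤ y) (hy1 : y ≤ 1) :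
    0 ≤ kernelR n x y := by
  unfold kernelR
  split_ifs
  · exact div_nonneg
      (sub_nonneg.mpr (mul_le_one₀ (pow_le_one₀ hx hx1) hy hy1))
      (sub_nonneg.mpr (pow_le_one₀ hy hy1))
  · exact div_nonneg (Finset.sum_nonneg fun _ _ => pow_nonneg hx _)
      (Finset.sum_nonneg fun _ _ => pow_nonneg hy _)
  · exact zero_le_one

lemma kernelR_le_one (n : ℕ) [NeZero n] {x y : ℝ} (hx : 0 ≤ x) (hx1 : x ≤ 1) (hy : 0 ≤ y) :
    kernelR n x y ≤ 1 := by
  have hn := NeZero.ne n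
  unfold kernelR
  split_ifs with h1 h2
  · refine div_le_one_of_le₀ ?_ (sub_nonneg.mpr (pow_le_one₀ hy (h1.le.trans hx1)))
    have h2 : y ^ n = y ^ (n - 1) * y := by
      rw [← pow_succ, Nat.sub_add_cancel (Nat.pos_of_ne_zero hn)]
    have h3 := mul_le_mul_of_nonneg_right (pow_le_pow_left₀ hy h1.le (n - 1)) hy
    linarith
  · exact div_le_one_of_le₀ (geom_sum_mono hx h2.le) (geom_sum_pos_of_nonneg hn hy).le
  · exact le_rfl

/-- Replacing the level `1` of nature by `y` costs at most the factor
`n / (1 + y + ⋯ + y ^ (n - 1))`. -/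
lemma kernelR_le_mul_kernelR_one (n : ℕ) [NeZero n] {x y : ℝ} (hx : 0 ≤ x) (hx1 : x ≤ 1)
    (hy : 0 ≤ y) :
    kernelR n x y ≤ n / (∑ k ∈ Finset.range n, y ^ k) * kernelR n x 1 := by
  have hn := NeZero.ne n
  have hn0 : (0 : ℝ) < n := by exact_mod_cast Nat.pos_of_ne_zero hn
  have hSy := geom_sum_pos_of_nonneg hn hy
  have hR1 : kernelR n x 1 = (∑ k ∈ Finset.range n, x ^ k) / n := by
    rcases hx1.eq_or_lt with rfl | hlt
    · simp [kernelR, hn]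
    · simp [kernelR, hlt, hlt.not_gt]
  have e : n / (∑ k ∈ Finset.range n, y ^ k) * kernelR n x 1
      = (∑ k ∈ Finset.range n, x ^ k) / (∑ k ∈ Finset.range n, y ^ k) := by
    rw [hR1]; field_simp
  rw [e]
  rcases lt_or_ge x y with hlt | hge
  · simp [kernelR, hlt, hlt.not_gt]
  · exact (kernelR_le_one n hx hx1 hy).trans ((one_le_div hSy).mpr (geom_sum_mono hy hge))

/-! ### The regret game -/

lemma kernelA_eq_of_le (n : ℕ) {x y : ℝ} (h : y ≤ x) :
    kernelA n x y = y * (x ^ (n - 1) - y ^ (n - 1)) := by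
  rcases h.eq_or_lt with rfl | h
  · simp [kernelA]
  · simp [kernelA, h]

lemma kernelA_eq_of_ge (m : ℕ) {x y : ℝ} (h : x ≤ y) :
    kernelA (m + 1) x y = (1 - y) *
      (∑ k ∈ Finset.range (m + 1), y ^ k - ∑ k ∈ Finset.range (m + 1), x ^ k) := by
  have e : ∑ k ∈ Finset.Icc 1 m, (y ^ k - x ^ k) = ∑ k ∈ Finset.range (m + 1), (y ^ k - x ^ k) := by
    rw [Finset.sum_range_succ', pow_zero, pow_zero, sub_self, add_zero, Finset.range_eq_Ico,
      Finset.sum_Ico_add' (fun k => y ^ k - x ^ k) 0 m 1]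
    rfl
  simp [kernelA, h.not_gt, e]

/-- A pure level for the decision maker and a two-point mixture for nature solve the
regret game. -/
lemma exists_regret_solution (n : ℕ) [NeZero n] :
    ∃ x₀ y₁ y₂ p w : ℝ, 0 ≤ x₀ ∧ x₀ ≤ 1 ∧ 0 ≤ y₁ ∧ y₁ ≤ y₂ ∧ y₂ ≤ 1 ∧ 0 ≤ p ∧ p ≤ 1 ∧
      (∀ y, 0 ≤ y → y ≤ 1 → kernelA n x₀ y ≤ w) ∧
      (∀ x, 0 ≤ x → x ≤ 1 → w ≤ p * kernelA n x y₁ + (1 - p) * kernelA n x y₂) := by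
  obtain ⟨m, rfl⟩ : ∃ m, n = m + 1 := ⟨n - 1, by have := NeZero.ne n; omega⟩
  rcases Nat.eq_zero_or_pos m with rfl | hm
  · refine ⟨0, 0, 0, 0, 0, le_rfl, zero_le_one, le_rfl, le_rfl, zero_le_one, le_rfl, zero_le_one,
      fun y hy hy1 => ?_, fun x hx hx1 => ?_⟩ <;> simp [kernelA]
  set S : ℝ → ℝ := fun x => ∑ k ∈ Finset.range (m + 1), x ^ k with hS
  set f : ℝ → ℝ → ℝ := fun x y => y * (x ^ m - y ^ m) with hf
  set g : ℝ → ℝ → ℝ := fun x y => (1 - y) * (S y - S x) with hg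
  have hScont : Continuous S := by fun_prop
  have hfcont : Continuous (fun q : ℝ × ℝ => f q.1 q.2) := by simp only [hf]; fun_prop
  have hgcont : Continuous (fun q : ℝ × ℝ => g q.1 q.2) := by simp only [hg]; fun_prop
  have hK : IsCompact (Icc (0 : ℝ) 1) := isCompact_Icc
  have hKne : (Icc (0 : ℝ) 1).Nonempty := ⟨0, by simp⟩
  have hfmax := fun x => hK.exists_sSup_image_eq_and_ge hKne
    (f := f x) (hfcont.comp (Continuous.prodMk_right x)).continuousOn
  have hgmax := fun x => hK.exists_sSup_image_eq_and_ge hKne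
    (f := g x) (hgcont.comp (Continuous.prodMk_right x)).continuousOn
  set φ : ℝ → ℝ := fun x => sSup (f x '' Icc 0 1) with hφ
  set ψ : ℝ → ℝ := fun x => sSup (g x '' Icc 0 1) with hψ
  have hφcont : Continuous φ := hK.continuous_sSup (f := f) hfcont
  have hψcont : Continuous ψ := hK.continuous_sSup (f := g) hgcont
  have hSlt : ∀ x y, 0 ≤ x → x < y → S x < S y := fun x y hx hxy =>
    Finset.sum_lt_sum (fun k _ => pow_le_pow_left₀ hx hxy.le _) ⟨1, by simp; omega, by simpa⟩
  have hSmono : ∀ x y, 0 ≤ x → x ≤ y → S x ≤ S y := fun x y hx hxy => geom_sum_mono hx hxy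
  have hle_φ : ∀ x y, y ∈ Icc (0 : ℝ) 1 → f x y ≤ φ x := fun x y hy => by
    obtain ⟨z, -, e, hz⟩ := hfmax x
    exact (hz y hy).trans_eq e.symm
  have hle_ψ : ∀ x y, y ∈ Icc (0 : ℝ) 1 → g x y ≤ ψ x := fun x y hy => by
    obtain ⟨z, -, e, hz⟩ := hgmax x
    exact (hz y hy).trans_eq e.symm
  have hφ0 : φ 0 ≤ 0 := by
    obtain ⟨z, hz, e, -⟩ := hfmax 0
    rw [show φ 0 = f 0 z from e]
    simp only [hf, zero_pow hm.ne']
    nlinarith [pow_nonneg hz.1 m, hz.1]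
  have hψ0 : 0 < ψ 0 := by
    refine lt_of_lt_of_le ?_ (hle_ψ 0 (1 / 2) (by constructor <;> norm_num))
    have := hSlt 0 (1 / 2) le_rfl (by norm_num)
    simp only [hg]; nlinarith
  have hψ1 : ψ 1 ≤ 0 := by
    obtain ⟨z, hz, e, -⟩ := hgmax 1
    rw [show ψ 1 = g 1 z from e]
    simp only [hg]
    nlinarith [hSmono z 1 hz.1 hz.2, hz.2]
  have hφ1 : 0 ≤ φ 1 := by
    simpa [hf] using hle_φ 1 0 (by simp)
  -- `φ` and `ψ` are the worst regrets from levels below and above `x`. Taking the maxima over all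
  -- of `[0, 1]` gives continuity and adds nothing once the common value is positive: `f x₀` is
  -- nonpositive above `x₀` and `g x₀` below it.
  obtain ⟨x₀, hx₀, he⟩ := intermediate_value_Icc (zero_le_one' ℝ)
    (hφcont.sub hψcont).continuousOn (show (0 : ℝ) ∈ Icc (φ 0 - ψ 0) (φ 1 - ψ 1) by
      constructor <;> linarith)
  replace he : φ x₀ = ψ x₀ := sub_eq_zero.mp he
  have hxpos : 0 < x₀ := by
    refine lt_of_le_of_ne hx₀.1 fun e => ?_
    rw [← e] at he; linarith
  set w : ℝ := φ x₀ with hw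
  have hwpos : 0 < w := by
    refine lt_of_lt_of_le ?_ (hle_φ x₀ (x₀ / 2) ⟨by linarith, by linarith [hx₀.2]⟩)
    have : (x₀ / 2) ^ m < x₀ ^ m := pow_lt_pow_left₀ (by linarith) (by linarith) hm.ne'
    simp only [hf]
    exact mul_pos (by linarith) (by linarith)
  obtain ⟨y₁, hy₁, e₁, -⟩ := hfmax x₀
  obtain ⟨y₂, hy₂, e₂, -⟩ := hgmax x₀
  have e₁ : w = y₁ * (x₀ ^ m - y₁ ^ m) := e₁
  have e₂ : w = (1 - y₂) * (S y₂ - S x₀) := he.trans e₂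
  have hy₁x : y₁ < x₀ := by
    by_contra! h
    nlinarith [pow_le_pow_left₀ hx₀.1 h m, hy₁.1]
  have hxy₂ : x₀ < y₂ := by
    by_contra! h
    nlinarith [hSmono _ _ hy₂.1 h, hy₂.2]
  have hy₁pos : 0 < y₁ := by
    refine lt_of_le_of_ne hy₁.1 fun e => ?_
    rw [← e, zero_mul] at e₁; linarith
  obtain ⟨C, hC, hCle⟩ := exists_sum_pow_sub_pow_le hxpos m hm
  have hq : 0 < y₁ + (1 - y₂) * C := by
    have := mul_nonneg (sub_nonneg.mpr hy₂.2) hC.le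
    linarith
  -- Between `y₁` and `y₂`, `A(x, y₁)` has slope `y₁` in `x ^ m`, and `A(x, y₂)` lies above a line
  -- of slope `-(1 - y₂) * C` touching it at `x₀`; the weight balances the two.
  set p : ℝ := (1 - y₂) * C / (y₁ + (1 - y₂) * C) with hp
  have hp0 : 0 ≤ p := div_nonneg (mul_nonneg (sub_nonneg.mpr hy₂.2) hC.le) hq.le
  have hp1 : p ≤ 1 := by rw [hp, div_le_one hq]; linarith
  have hpa : p * y₁ = (1 - p) * ((1 - y₂) * C) := by
    rw [hp]; field_simp; ring
  have hmix : ∀ x, y₁ ≤ x → x ≤ y₂ →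
      w ≤ p * kernelA (m + 1) x y₁ + (1 - p) * kernelA (m + 1) x y₂ := by
    intro x h1 h2
    rw [kernelA_eq_of_le _ h1, kernelA_eq_of_ge m h2, Nat.add_sub_cancel]
    change w ≤ p * (y₁ * (x ^ m - y₁ ^ m)) + (1 - p) * ((1 - y₂) * (S y₂ - S x))
    have h3 := hCle x (hy₁.1.trans h1)
    rw [Finset.sum_sub_distrib] at h3
    change S x - S x₀ ≤ _ at h3
    have h4 := mul_le_mul_of_nonneg_left h3
      (mul_nonneg (sub_nonneg.mpr hp1) (sub_nonneg.mpr hy₂.2))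
    have h5 : w = p * (y₁ * (x₀ ^ m - y₁ ^ m)) + (1 - p) * ((1 - y₂) * (S y₂ - S x₀)) := by
      rw [← e₁, ← e₂]; ring
    have h6 : p * y₁ * (x ^ m - x₀ ^ m) = (1 - p) * ((1 - y₂) * C) * (x ^ m - x₀ ^ m) := by
      rw [hpa]
    linarith
  refine ⟨x₀, y₁, y₂, p, w, hx₀.1, hx₀.2, hy₁.1, (hy₁x.trans hxy₂).le, hy₂.2, hp0, hp1,
    fun y hy hy1 => ?_, fun x hx hx1 => ?_⟩
  · rcases le_total y x₀ with h | h
    · rw [kernelA_eq_of_le _ h]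
      exact hle_φ x₀ y ⟨hy, hy1⟩
    · rw [kernelA_eq_of_ge m h, he]
      exact hle_ψ x₀ y ⟨hy, hy1⟩
  · have hy12 := (hy₁x.trans hxy₂).le
    -- Outside `[y₁, y₂]` both kernels grow as `x` moves away from the interval, so the nearer
    -- endpoint gives the lower bound.
    rcases le_or_gt y₁ x with h1 | h1
    · rcases le_or_gt x y₂ with h2 | h2
      · exact hmix x h1 h2
      · refine (hmix y₂ hy12 le_rfl).trans ?_
        rw [kernelA_eq_of_le _ hy12, kernelA_eq_of_le _ le_rfl, kernelA_eq_of_le _ h1,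
          kernelA_eq_of_le _ h2.le, sub_self, mul_zero]
        have h3 : y₂ ^ (m + 1 - 1) ≤ x ^ (m + 1 - 1) := pow_le_pow_left₀ hy₂.1 h2.le _
        have h4 : 0 ≤ y₂ * (x ^ (m + 1 - 1) - y₂ ^ (m + 1 - 1)) :=
          mul_nonneg hy₂.1 (by linarith)
        have h5 := mul_nonneg (sub_nonneg.mpr hp1) h4
        have h6 := mul_le_mul_of_nonneg_left h3 (mul_nonneg hp0 hy₁.1)
        linarith
    · refine (hmix y₁ le_rfl hy12).trans ?_
      rw [kernelA_eq_of_ge m le_rfl, kernelA_eq_of_ge m hy12, kernelA_eq_of_ge m h1.le,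
        kernelA_eq_of_ge m (h1.le.trans hy12), sub_self, mul_zero]
      have h3 := hSmono x y₁ hx h1.le
      change p * 0 + (1 - p) * ((1 - y₂) * (S y₂ - S y₁))
        ≤ p * ((1 - y₁) * (S y₁ - S x)) + (1 - p) * ((1 - y₂) * (S y₂ - S x))
      have h4 := mul_nonneg hp0 (mul_nonneg (sub_nonneg.mpr hy₁.2) (sub_nonneg.mpr h3))
      have h5 := mul_le_mul_of_nonneg_left h3
        (mul_nonneg (sub_nonneg.mpr hp1) (sub_nonneg.mpr hy₂.2))
      linarith

/-! ### A single observation -/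

/-- The law of an observation together with its coin. -/
def stepLaw (F : ProbabilityMeasure ℝ≥0) (p : I) : Measure (ℝ≥0 × Bool) :=
  (F : Measure ℝ≥0).prod (bernoulliMeasure true false p)

instance (F : ProbabilityMeasure ℝ≥0) (p : I) : IsProbabilityMeasure (stepLaw F p) := by
  unfold stepLaw; infer_instance

/-- The probability that a single observation is rejected. -/
def rejectProb (τ : ThresholdRule) (F : ProbabilityMeasure ℝ≥0) : ℝ :=
  (stepLaw F τ.p).real {ω | ¬ τ.Accepts ω}

/-- The distribution function as a function of a real variable. -/
def realCdf (F : ProbabilityMeasure ℝ≥0) (s : ℝ) : ℝ :=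
  (F : Measure ℝ≥0).real {z | (z : ℝ) ≤ s}

lemma measurableSet_accepts (τ : ThresholdRule) : MeasurableSet {ω | τ.Accepts ω} := by
  refine MeasurableSet.union ?_ (MeasurableSet.inter ?_ ?_)
  · exact measurableSet_lt measurable_const (measurable_coe_nnreal_ennreal.comp measurable_fst)
  · exact measurableSet_eq_fun (measurable_coe_nnreal_ennreal.comp measurable_fst) measurable_const
  · exact measurable_snd (measurableSet_singleton true)

lemma rejectProb_nonneg (τ : ThresholdRule) (F : ProbabilityMeasure ℝ≥0) : 0 ≤ rejectProb τ F :=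
  measureReal_nonneg

lemma rejectProb_le_one (τ : ThresholdRule) (F : ProbabilityMeasure ℝ≥0) : rejectProb τ F ≤ 1 :=
  measureReal_le_one

lemma realCdf_nonneg (F : ProbabilityMeasure ℝ≥0) (s : ℝ) : 0 ≤ realCdf F s := measureReal_nonneg

lemma realCdf_le_one (F : ProbabilityMeasure ℝ≥0) (s : ℝ) : realCdf F s ≤ 1 := measureReal_le_one

lemma realCdf_mono (F : ProbabilityMeasure ℝ≥0) : Monotone (realCdf F) := fun _ _ hst =>
  measureReal_mono fun z (hz : (z : ℝ) ≤ _) => (le_trans hz hst : (z : ℝ) ≤ _)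

lemma measureReal_lt_coe (F : ProbabilityMeasure ℝ≥0) (s : ℝ) :
    (F : Measure ℝ≥0).real {z | s < (z : ℝ)} = 1 - realCdf F s := by
  have h : MeasurableSet {z : ℝ≥0 | (z : ℝ) ≤ s} :=
    measurableSet_le measurable_coe_nnreal_real measurable_const
  rw [realCdf, ← probReal_compl_eq_one_sub h]
  congr 1; ext z; simp

lemma stepLaw_measureReal_lt (F : ProbabilityMeasure ℝ≥0) (p : I) (s : ℝ) :
    (stepLaw F p).real {ω | s < (ω.1 : ℝ)} = 1 - realCdf F s := by
  rw [← measureReal_lt_coe]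
  have : {ω : ℝ≥0 × Bool | s < (ω.1 : ℝ)} = {z : ℝ≥0 | s < (z : ℝ)} ×ˢ univ := by ext; simp
  rw [this, stepLaw, measureReal_prod_prod]; simp

lemma stepLaw_measureReal_accepts (τ : ThresholdRule) (F : ProbabilityMeasure ℝ≥0) :
    (stepLaw F τ.p).real {ω | τ.Accepts ω} = 1 - rejectProb τ F := by
  have : {ω | ¬ τ.Accepts ω} = {ω | τ.Accepts ω}ᶜ := rfl
  rw [rejectProb, this, probReal_compl_eq_one_sub (measurableSet_accepts τ)]
  ring

/-- If `s < θ`, acceptance implies exceeding `s`; if `θ ≤ s`, exceeding `s` implies acceptance. One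
event contains the other, so the intersection has the smaller of the two probabilities. This removes
the threshold and the coin from the reward, leaving only the rejection probability. -/
lemma stepLaw_measureReal_lt_inter_accepts (τ : ThresholdRule) (F : ProbabilityMeasure ℝ≥0)
    {s : ℝ} (hs : 0 ≤ s) :
    (stepLaw F τ.p).real ({ω | s < (ω.1 : ℝ)} ∩ {ω | τ.Accepts ω})
      = 1 - max (rejectProb τ F) (realCdf F s) := by
  lift s to ℝ≥0 using hs
  have hlt : ∀ z : ℝ≥0, (s : ℝ) < z ↔ (s : ℝ≥0∞) < z := fun z => by
    rw [NNReal.coe_lt_coe, ENNReal.coe_lt_coe]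
  have h1 := stepLaw_measureReal_lt F τ.p s
  have h2 := stepLaw_measureReal_accepts τ F
  rcases lt_or_ge (s : ℝ≥0∞) τ.θ with h | h
  · have hsub : {ω | τ.Accepts ω} ⊆ {ω | (s : ℝ) < (ω.1 : ℝ)} := by
      rintro ω (hω | ⟨hω, -⟩)
      · exact (hlt _).mpr (h.trans hω)
      · exact (hlt _).mpr (hω ▸ h)
    have h3 := measureReal_mono (μ := stepLaw F τ.p) hsub
    rw [inter_eq_right.mpr hsub, h2, max_eq_left (by linarith)]
  · have hsub : {ω | (s : ℝ) < (ω.1 : ℝ)} ⊆ {ω | τ.Accepts ω} := fun ω hω =>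
      Or.inl (h.trans_lt ((hlt _).mp hω))
    have h3 := measureReal_mono (μ := stepLaw F τ.p) hsub
    rw [inter_eq_left.mpr hsub, h1, max_eq_right (by linarith)]

lemma integrable_fst_stepLaw {F : ProbabilityMeasure ℝ≥0}
    (hF : Integrable (fun x : ℝ≥0 => (x : ℝ)) (F : Measure ℝ≥0)) (p : I) :
    Integrable (fun ω : ℝ≥0 × Bool => (ω.1 : ℝ)) (stepLaw F p) :=
  hF.comp_fst _

lemma integral_fst_stepLaw {F : ProbabilityMeasure ℝ≥0}
    (hF : Integrable (fun x : ℝ≥0 => (x : ℝ)) (F : Measure ℝ≥0)) (p : I) :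
    ∫ ω, (ω.1 : ℝ) ∂(stepLaw F p) = ∫ s in Ioi (0 : ℝ), (1 - realCdf F s) := by
  rw [(integrable_fst_stepLaw hF p).integral_eq_integral_meas_lt (.of_forall fun ω => ω.1.2)]
  simp_rw [stepLaw_measureReal_lt]

lemma integral_indicator_accepts (τ : ThresholdRule) {F : ProbabilityMeasure ℝ≥0}
    (hF : Integrable (fun x : ℝ≥0 => (x : ℝ)) (F : Measure ℝ≥0)) :
    ∫ ω, {ω | τ.Accepts ω}.indicator (fun ω => (ω.1 : ℝ)) ω ∂(stepLaw F τ.p)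
      = ∫ s in Ioi (0 : ℝ), (1 - max (rejectProb τ F) (realCdf F s)) := by
  rw [((integrable_fst_stepLaw hF τ.p).indicator
    (measurableSet_accepts τ)).integral_eq_integral_meas_lt
    (.of_forall fun ω => indicator_nonneg (fun ω _ => ω.1.2) ω)]
  refine setIntegral_congr_fun measurableSet_Ioi fun s hs => ?_
  rw [← stepLaw_measureReal_lt_inter_accepts τ F (le_of_lt hs)]
  congr 1
  ext ω
  by_cases h : ω ∈ {ω | τ.Accepts ω}
  · simp [h]
  · simpa [h] using le_of_lt hs

/-! ### The tail integral -/

lemma integrableOn_one_sub_realCdf {F : ProbabilityMeasure ℝ≥0}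
    (hF : Integrable (fun x : ℝ≥0 => (x : ℝ)) (F : Measure ℝ≥0)) :
    IntegrableOn (fun s => 1 - realCdf F s) (Ioi 0) := by
  have h := lintegral_eq_lintegral_meas_lt (F : Measure ℝ≥0) (f := fun x : ℝ≥0 => (x : ℝ))
    (.of_forall fun x => x.2) hF.aemeasurable
  have hmeas : Measurable fun t : ℝ => (F : Measure ℝ≥0) {a : ℝ≥0 | t < (a : ℝ)} :=
    Antitone.measurable fun _ _ hst => measure_mono fun _ h => lt_of_le_of_lt hst h
  have h2 := integrable_toReal_of_lintegral_ne_top hmeas.aemeasurable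
    (h ▸ hF.lintegral_lt_top.ne : ∫⁻ t in Ioi 0, (F : Measure ℝ≥0) {a : ℝ≥0 | t < (a : ℝ)} ≠ ∞)
  refine h2.congr (.of_forall fun s => ?_)
  exact measureReal_lt_coe F s

/-- The tail `1 - F` is integrable because the mean is finite, and it dominates any function of `F`
that vanishes at least linearly at `F = 1`. -/
lemma integrableOn_comp_realCdf {F : ProbabilityMeasure ℝ≥0}
    (hF : Integrable (fun x : ℝ≥0 => (x : ℝ)) (F : Measure ℝ≥0)) {φ : ℝ → ℝ} (hφ : Measurable φ)
    (K : ℝ) (hK : ∀ y, 0 ≤ y → y ≤ 1 → |φ y| ≤ K * (1 - y)) :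
    IntegrableOn (fun s => φ (realCdf F s)) (Ioi 0) :=
  ((integrableOn_one_sub_realCdf hF).const_mul K).mono'
    (hφ.comp (realCdf_mono F).measurable).aestronglyMeasurable
    (.of_forall fun s => hK _ (realCdf_nonneg F s) (realCdf_le_one F s))

/-! ### The prophet -/

lemma prophet_eq_integral (n : ℕ) {F : ProbabilityMeasure ℝ≥0}
    (hF : Integrable (fun x : ℝ≥0 => (x : ℝ)) (F : Measure ℝ≥0)) :
    prophet n F = ∫ s in Ioi (0 : ℝ), (1 - realCdf F s ^ n) := by
  have hmeas : Measurable fun X : Fin n → ℝ≥0 => ((Finset.univ.sup X : ℝ≥0) : ℝ) := by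
    refine measurable_coe_nnreal_real.comp ?_
    exact (Continuous.finset_sup_apply fun i _ => continuous_apply i).measurable
  have hint : Integrable (fun X : Fin n → ℝ≥0 => ((Finset.univ.sup X : ℝ≥0) : ℝ))
      (Measure.pi fun _ => (F : Measure ℝ≥0)) := by
    have hsum : Integrable (fun X : Fin n → ℝ≥0 => ∑ i, (X i : ℝ))
        (Measure.pi fun _ => (F : Measure ℝ≥0)) :=
      integrable_finsetSum _ fun i _ =>
        (measurePreserving_eval (fun _ : Fin n => (F : Measure ℝ≥0)) i).integrable_comp_of_integrable hF
    refine hsum.mono' hmeas.aestronglyMeasurable (.of_forall fun X => ?_)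
    rw [Real.norm_of_nonneg (NNReal.coe_nonneg _), ← NNReal.coe_sum, NNReal.coe_le_coe]
    exact Finset.sup_le fun i _ => Finset.single_le_sum (fun _ _ => zero_le) (Finset.mem_univ i)
  rw [prophet, hint.integral_eq_integral_meas_lt (.of_forall fun X => NNReal.coe_nonneg _)]
  refine setIntegral_congr_fun measurableSet_Ioi fun s hs => ?_
  have hc : {X : Fin n → ℝ≥0 | s < ((Finset.univ.sup X : ℝ≥0) : ℝ)}
      = (univ.pi fun _ => {z : ℝ≥0 | (z : ℝ) ≤ s})ᶜ := by
    ext X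
    have hs' : (0 : ℝ) < s := hs
    lift s to ℝ≥0 using hs'.le
    simp [Finset.lt_sup_iff]
  rw [hc, probReal_compl_eq_one_sub]
  · simp [measureReal_def, Measure.pi_pi, realCdf]
  · exact MeasurableSet.univ_pi fun _ => measurableSet_le measurable_coe_nnreal_real measurable_const

/-! ### The reward of a threshold rule -/

/-- The reward of a rule with rejection probability `x` when an observation is `1` with probability
`1 - y` and `0` otherwise. -/
def levelReward (n : ℕ) (x y : ℝ) : ℝ :=
  (∑ k ∈ Finset.range (n - 1), x ^ k) * (1 - max x y) + x ^ (n - 1) * (1 - y)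

open Classical in
/-- The factor of the observation `i` in the reward collected by stopping at the time `t`. -/
def stopFactor (τ : ThresholdRule) {n : ℕ} [NeZero n] (t i : Fin n) : ℝ≥0 × Bool → ℝ :=
  if i < t then {ω | ¬ τ.Accepts ω}.indicator 1
  else if i = t then
    if t = ⊤ then fun ω => (ω.1 : ℝ) else {ω | τ.Accepts ω}.indicator fun ω => (ω.1 : ℝ)
  else 1

open Classical in
-- Only the summand of the actual stopping time survives: an earlier `t` has a rejected observation
-- at `t`, and for a later `t` the accepted observation at the stopping time should have been
-- rejected. In this product form, independence gives the expectation factor by factor.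
lemma coe_time_eq_sum (τ : ThresholdRule) {n : ℕ} [NeZero n] (ω : Fin n → ℝ≥0 × Bool) :
    ((ω (τ.time ω)).1 : ℝ) = ∑ t, ∏ i, stopFactor τ t i (ω i) := by
  set T := τ.time ω with hT
  have hmem : T ∈ Finset.univ.filter fun t => τ.Accepts (ω t) ∨ t = ⊤ := Finset.min'_mem _ _
  have hTacc : τ.Accepts (ω T) ∨ T = ⊤ := (Finset.mem_filter.mp hmem).2
  have hlt : ∀ t < T, ¬ τ.Accepts (ω t) := fun t ht hacc =>
    absurd (Finset.min'_le _ t (Finset.mem_filter.mpr ⟨Finset.mem_univ t, Or.inl hacc⟩))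
      (not_le.mpr ht)
  rw [Finset.sum_eq_single T]
  · rw [Finset.prod_eq_single T]
    · by_cases h : T = ⊤
      · simp [stopFactor, h]
      · simp [stopFactor, h, hTacc.resolve_right h]
    · intro i _ hi
      rcases lt_or_gt_of_ne hi with h | h
      · simp [stopFactor, h, hlt i h]
      · simp [stopFactor, h.not_gt, hi]
    · simp
  · intro t _ ht
    rcases lt_or_gt_of_ne ht with h | h
    · refine Finset.prod_eq_zero (Finset.mem_univ t) ?_
      have : t ≠ ⊤ := (h.trans_le le_top).ne
      simp [stopFactor, this, hlt t h]
    · refine Finset.prod_eq_zero (Finset.mem_univ T) ?_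
      have : T ≠ ⊤ := (h.trans_le le_top).ne
      simp [stopFactor, h, hTacc.resolve_right this]
  · simp

lemma integrable_stopFactor (τ : ThresholdRule) {n : ℕ} [NeZero n] {F : ProbabilityMeasure ℝ≥0}
    (hF : Integrable (fun x : ℝ≥0 => (x : ℝ)) (F : Measure ℝ≥0)) (t i : Fin n) :
    Integrable (stopFactor τ t i) (stepLaw F τ.p) := by
  have hX := integrable_fst_stepLaw hF τ.p
  unfold stopFactor
  split_ifs
  · exact (integrable_const (1 : ℝ)).indicator (measurableSet_accepts τ).compl
  · exact hX
  · exact hX.indicator (measurableSet_accepts τ)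
  · exact integrable_const (1 : ℝ)

lemma integral_prod_stopFactor (τ : ThresholdRule) {n : ℕ} [NeZero n] (F : ProbabilityMeasure ℝ≥0)
    (t : Fin n) :
    ∫ ω, ∏ i, stopFactor τ t i (ω i) ∂(sampleLaw n F τ.p)
      = rejectProb τ F ^ (t : ℕ) * ∫ ω, stopFactor τ t t ω ∂(stepLaw F τ.p) := by
  change ∫ ω, ∏ i, stopFactor τ t i (ω i) ∂(Measure.pi fun _ => stepLaw F τ.p) = _
  rw [integral_fintype_prod_eq_prod]
  have hrej : ∫ ω, {ω | ¬ τ.Accepts ω}.indicator 1 ω ∂(stepLaw F τ.p) = rejectProb τ F :=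
    integral_indicator_one (measurableSet_accepts τ).compl
  have hfac : ∀ i, ∫ ω, stopFactor τ t i ω ∂(stepLaw F τ.p)
      = (if i < t then rejectProb τ F else 1) *
        (if i = t then ∫ ω, stopFactor τ t t ω ∂(stepLaw F τ.p) else 1) := by
    intro i
    rcases lt_trichotomy i t with h | rfl | h
    · simp [h, h.ne, stopFactor, hrej]
    · rw [if_neg (lt_irrefl _), if_pos rfl, one_mul]
    · simp [h.not_gt, h.ne', stopFactor]
  rw [Finset.prod_congr rfl fun i _ => hfac i, Finset.prod_mul_distrib, Finset.prod_ite_eq' Finset.univ t, if_pos (Finset.mem_univ t),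
    Finset.prod_ite, Finset.prod_const, Finset.prod_const_one, mul_one]
  have : Finset.univ.filter (fun i => i < t) = Finset.Iio t := by ext; simp
  rw [this, Fin.card_Iio]

lemma reward_eq (n : ℕ) [NeZero n] (τ : ThresholdRule) {F : ProbabilityMeasure ℝ≥0}
    (hF : Integrable (fun x : ℝ≥0 => (x : ℝ)) (F : Measure ℝ≥0)) :
    reward n τ F = (∑ k ∈ Finset.range (n - 1), rejectProb τ F ^ k) *
        (∫ ω, {ω | τ.Accepts ω}.indicator (fun ω => (ω.1 : ℝ)) ω ∂(stepLaw F τ.p))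
      + rejectProb τ F ^ (n - 1) * ∫ ω, (ω.1 : ℝ) ∂(stepLaw F τ.p) := by
  obtain ⟨m, rfl⟩ : ∃ m, n = m + 1 := ⟨n - 1, by have := NeZero.ne n; omega⟩
  simp_rw [reward, coe_time_eq_sum]
  rw [integral_finsetSum]
  · simp_rw [integral_prod_stopFactor]
    rw [Fin.sum_univ_castSucc, Nat.add_sub_cancel, Finset.sum_mul, Finset.sum_range]
    congr 1
    · refine Finset.sum_congr rfl fun t _ => ?_
      have : t.castSucc ≠ ⊤ := (Fin.castSucc_lt_last t).ne
      simp [stopFactor, this]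
    · have : Fin.last m = ⊤ := rfl
      simp [stopFactor, this]
  · exact fun t _ => Integrable.fintype_prod fun i => integrable_stopFactor τ hF t i

lemma integrableOn_one_sub_max {F : ProbabilityMeasure ℝ≥0}
    (hF : Integrable (fun x : ℝ≥0 => (x : ℝ)) (F : Measure ℝ≥0)) {x : ℝ} (hx1 : x ≤ 1) :
    IntegrableOn (fun s => 1 - max x (realCdf F s)) (Ioi 0) := by
  refine integrableOn_comp_realCdf hF (φ := fun y => 1 - max x y) (by fun_prop) 1
    fun y _ hy1 => ?_
  rw [abs_of_nonneg (sub_nonneg.mpr (max_le hx1 hy1))]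
  linarith [le_max_right x y]

lemma integrableOn_levelReward (n : ℕ) {F : ProbabilityMeasure ℝ≥0}
    (hF : Integrable (fun x : ℝ≥0 => (x : ℝ)) (F : Measure ℝ≥0)) {x : ℝ} (hx1 : x ≤ 1) :
    IntegrableOn (fun s => levelReward n x (realCdf F s)) (Ioi 0) :=
  ((integrableOn_one_sub_max hF hx1).const_mul _).add
    ((integrableOn_one_sub_realCdf hF).const_mul _)

lemma integrableOn_one_sub_pow (n : ℕ) {F : ProbabilityMeasure ℝ≥0}
    (hF : Integrable (fun x : ℝ≥0 => (x : ℝ)) (F : Measure ℝ≥0)) :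
    IntegrableOn (fun s => 1 - realCdf F s ^ n) (Ioi 0) := by
  refine integrableOn_comp_realCdf hF (φ := fun y => 1 - y ^ n) (by fun_prop) n
    fun y hy hy1 => ?_
  rw [abs_of_nonneg (sub_nonneg.mpr (pow_le_one₀ hy hy1)), ← geom_sum_mul_one_sub]
  exact mul_le_mul_of_nonneg_right (geom_sum_le hy hy1) (sub_nonneg.mpr hy1)

lemma reward_eq_integral (n : ℕ) [NeZero n] (τ : ThresholdRule) {F : ProbabilityMeasure ℝ≥0}
    (hF : Integrable (fun x : ℝ≥0 => (x : ℝ)) (F : Measure ℝ≥0)) :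
    reward n τ F = ∫ s in Ioi (0 : ℝ), levelReward n (rejectProb τ F) (realCdf F s) := by
  rw [reward_eq n τ hF, integral_indicator_accepts τ hF, integral_fst_stepLaw hF]
  simp only [levelReward]
  rw [integral_add ((integrableOn_one_sub_max hF (rejectProb_le_one τ F)).const_mul _)
    ((integrableOn_one_sub_realCdf hF).const_mul _), integral_const_mul, integral_const_mul]

lemma levelReward_eq_of_le (n : ℕ) {x y : ℝ} (h : y ≤ x) :
    levelReward n x y = 1 - x ^ (n - 1) * y := by
  rw [levelReward, max_eq_left h, geom_sum_mul_one_sub]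
  ring

lemma levelReward_eq_of_ge (n : ℕ) [NeZero n] {x y : ℝ} (h : x ≤ y) :
    levelReward n x y = (∑ k ∈ Finset.range n, x ^ k) * (1 - y) := by
  obtain ⟨m, rfl⟩ : ∃ m, n = m + 1 := ⟨n - 1, by have := NeZero.ne n; omega⟩
  rw [levelReward, max_eq_right h, Nat.add_sub_cancel, Finset.sum_range_succ]
  ring

/-- This exhibits the ratio as an average of `R(x, F(s))` with weight `1 - F(s) ^ n`. At `y = 1`
both sides vanish, so the value of the kernel there is invisible to any single distribution. -/
lemma kernelR_mul_one_sub_pow (n : ℕ) [NeZero n] {x y : ℝ} (hx : 0 ≤ x) (hx1 : x ≤ 1)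
    (hy : 0 ≤ y) : kernelR n x y * (1 - y ^ n) = levelReward n x y := by
  have hn := NeZero.ne n
  rcases lt_trichotomy y x with h | rfl | h
  · rw [levelReward_eq_of_le n h.le]
    simp only [kernelR, h, if_true]
    have : 0 < 1 - y ^ n := by linarith [pow_lt_one₀ hy (h.trans_le hx1) hn]
    exact div_mul_cancel₀ _ this.ne'
  · rw [levelReward_eq_of_ge n le_rfl, geom_sum_mul_one_sub]
    simp [kernelR]
  · rw [levelReward_eq_of_ge n h.le]
    simp only [kernelR, h, h.not_gt, if_true, if_false]
    rw [← geom_sum_mul_one_sub]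
    have := (geom_sum_pos_of_nonneg hn hy).ne'
    field_simp

lemma one_sub_pow_sub_levelReward (n : ℕ) [NeZero n] (x y : ℝ) :
    1 - y ^ n - levelReward n x y = kernelA n x y := by
  obtain ⟨m, rfl⟩ : ∃ m, n = m + 1 := ⟨n - 1, by have := NeZero.ne n; omega⟩
  rcases le_total y x with h | h
  · rw [levelReward_eq_of_le _ h, kernelA_eq_of_le _ h, Nat.add_sub_cancel]
    ring
  · rw [levelReward_eq_of_ge _ h, kernelA_eq_of_ge m h, ← geom_sum_mul_one_sub]
    ring

lemma regret_eq_integral (n : ℕ) [NeZero n] (τ : ThresholdRule) {F : ProbabilityMeasure ℝ≥0}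
    (hF : Integrable (fun x : ℝ≥0 => (x : ℝ)) (F : Measure ℝ≥0)) :
    regret n τ F = ∫ s in Ioi (0 : ℝ), kernelA n (rejectProb τ F) (realCdf F s) := by
  rw [regret, prophet_eq_integral n hF, reward_eq_integral n τ hF,
    ← integral_sub (integrableOn_one_sub_pow n hF)
      (integrableOn_levelReward n hF (rejectProb_le_one τ F))]
  simp_rw [one_sub_pow_sub_levelReward]

/-! ### Rules given by a quantile level -/

lemma rejectProb_eq (τ : ThresholdRule) (F : ProbabilityMeasure ℝ≥0) :
    rejectProb τ F = cdfLeft F τ.θ + (cdfAt F τ.θ - cdfLeft F τ.θ) * (1 - τ.p) := by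
  have hlt : MeasurableSet {z : ℝ≥0 | (z : ℝ≥0∞) < τ.θ} :=
    measurableSet_lt measurable_coe_nnreal_ennreal measurable_const
  have heq : MeasurableSet {z : ℝ≥0 | (z : ℝ≥0∞) = τ.θ} :=
    measurableSet_eq_fun measurable_coe_nnreal_ennreal measurable_const
  have hcdf : cdfAt F τ.θ = cdfLeft F τ.θ + (F : Measure ℝ≥0).real {z | (z : ℝ≥0∞) = τ.θ} := by
    rw [cdfAt, cdfLeft, ← measureReal_union (Set.disjoint_left.mpr fun z h1 h2 => h1.ne h2) heq]
    congr 1; ext z; simp [le_iff_lt_or_eq]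
  have hset : {ω | ¬ τ.Accepts ω} = {z : ℝ≥0 | (z : ℝ≥0∞) < τ.θ} ×ˢ (univ : Set Bool) ∪
      {z : ℝ≥0 | (z : ℝ≥0∞) = τ.θ} ×ˢ ({false} : Set Bool) := by
    ext ⟨z, b⟩
    rcases lt_trichotomy (z : ℝ≥0∞) τ.θ with h | h | h
    · simp [ThresholdRule.Accepts, h, h.le, h.ne]
    · simp [ThresholdRule.Accepts, h]
    · simp [ThresholdRule.Accepts, h, h.not_gt, h.ne']
  have hdisj : Disjoint ({z : ℝ≥0 | (z : ℝ≥0∞) < τ.θ} ×ˢ (univ : Set Bool))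
      ({z : ℝ≥0 | (z : ℝ≥0∞) = τ.θ} ×ˢ ({false} : Set Bool)) :=
    Set.disjoint_left.mpr fun ω h1 h2 => h1.1.ne h2.1
  rw [rejectProb, hset, measureReal_union hdisj (heq.prod (measurableSet_singleton _)), stepLaw,
    measureReal_prod_prod, measureReal_prod_prod, hcdf, cdfLeft, add_sub_cancel_left]
  simp

lemma rejectProb_levelRule (x : I) (F : ProbabilityMeasure ℝ≥0) :
    rejectProb (levelRule x F) F = x := by
  rw [rejectProb_eq]
  have h1 := le_cdfAt_quantile F x
  have h2 := cdfLeft_quantile_le F x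
  change cdfLeft F (quantile F x) + (cdfAt F (quantile F x) - cdfLeft F (quantile F x)) *
    (1 - levelProb F x) = x
  rcases (h2.trans h1).eq_or_lt with h | h
  -- Without an atom at the threshold the coin is irrelevant, so the value of `levelProb` given by
  -- division by zero does no harm; `x` is squeezed between the equal one-sided values.
  · rw [h, sub_self, zero_mul]; linarith
  · rw [levelProb]
    have : cdfAt F (quantile F x) - cdfLeft F (quantile F x) ≠ 0 := by linarith
    field_simp; ring

lemma quantile_ne_top (F : ProbabilityMeasure ℝ≥0) {x : ℝ} {z : ℝ≥0} (h : x ≤ realCdf F z) :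
    quantile F x ≠ ∞ := by
  refine ne_top_of_le_ne_top (ENNReal.coe_ne_top (r := z)) (sInf_le ⟨z, rfl, ?_⟩)
  simpa [cdfAt, realCdf] using h

lemma exists_le_realCdf (F : ProbabilityMeasure ℝ≥0) {x : ℝ} (hx : x < 1) :
    ∃ z : ℝ≥0, x ≤ realCdf F z := by
  have hmono : Monotone fun k : ℕ => {z : ℝ≥0 | (z : ℝ) ≤ (k : ℝ≥0)} :=
    fun i j hij z (hz : (z : ℝ) ≤ _) => le_trans hz (by exact_mod_cast hij)
  have h := tendsto_measure_iUnion_atTop (μ := (F : Measure ℝ≥0)) hmono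
  have hU : ⋃ k : ℕ, {z : ℝ≥0 | (z : ℝ) ≤ (k : ℝ≥0)} = univ := by
    refine eq_univ_of_forall fun z => ?_
    obtain ⟨k, hk⟩ := exists_nat_ge z
    exact mem_iUnion.mpr ⟨k, by exact_mod_cast hk⟩
  rw [hU, measure_univ] at h
  have h' := (ENNReal.tendsto_toReal ENNReal.one_ne_top).comp h
  obtain ⟨k, hk⟩ := (h'.eventually_const_lt (show x < (1 : ℝ≥0∞).toReal by simpa)).exists
  exact ⟨k, hk.le⟩

/-! ### Three-point distributions -/

/-- The distribution with mass `y₀` at `0`, mass `y₁ - y₀` at `a` and mass `1 - y₁` at `a + b`. -/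
def threePoint (y₀ y₁ : ℝ) (hy₀ : 0 ≤ y₀) (hy : y₀ ≤ y₁) (hy₁ : y₁ ≤ 1) (a b : ℝ≥0) :
    ProbabilityMeasure ℝ≥0 :=
  ⟨ENNReal.ofReal y₀ • Measure.dirac 0 + ENNReal.ofReal (y₁ - y₀) • Measure.dirac a +
    ENNReal.ofReal (1 - y₁) • Measure.dirac (a + b), ⟨by
      simp only [Measure.add_apply, Measure.smul_apply, measure_univ, smul_eq_mul, mul_one]
      rw [← ENNReal.ofReal_add hy₀ (by linarith), ← ENNReal.ofReal_add (by linarith) (by linarith)]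
      simp⟩⟩

section ThreePoint

variable {y₀ y₁ : ℝ} {hy₀ : 0 ≤ y₀} {hy : y₀ ≤ y₁} {hy₁ : y₁ ≤ 1} {a b : ℝ≥0}

lemma ae_threePoint {P : ℝ≥0 → Prop} (h0 : P 0) (ha : P a) (hb : P (a + b)) :
    ∀ᵐ x ∂(threePoint y₀ y₁ hy₀ hy hy₁ a b : Measure ℝ≥0), P x := by
  change ∀ᵐ x ∂(ENNReal.ofReal y₀ • Measure.dirac 0 + ENNReal.ofReal (y₁ - y₀) • Measure.dirac a +
    ENNReal.ofReal (1 - y₁) • Measure.dirac (a + b)), P x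
  rw [ae_add_measure_iff, ae_add_measure_iff]
  refine ⟨⟨?_, ?_⟩, ?_⟩ <;> refine Measure.ae_smul_measure ?_ _ <;> simpa [ae_dirac_eq]

lemma integrable_threePoint :
    Integrable (fun x : ℝ≥0 => (x : ℝ)) (threePoint y₀ y₁ hy₀ hy hy₁ a b : Measure ℝ≥0) := by
  refine (integrable_const ((a + b : ℝ≥0) : ℝ)).mono'
    measurable_coe_nnreal_real.aestronglyMeasurable ?_
  have h : ∀ z : ℝ≥0, z ≤ a + b → ‖(z : ℝ)‖ ≤ ((a + b : ℝ≥0) : ℝ) := fun z hz => by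
    rw [Real.norm_of_nonneg (NNReal.coe_nonneg z)]
    exact NNReal.coe_le_coe.mpr hz
  exact ae_threePoint (h _ zero_le) (h _ le_self_add) (h _ le_rfl)

lemma realCdf_threePoint {s : ℝ} (hs : 0 ≤ s) :
    realCdf (threePoint y₀ y₁ hy₀ hy hy₁ a b) s
      = if s < a then y₀ else if s < (a : ℝ) + b then y₁ else 1 := by
  have hm : MeasurableSet {z : ℝ≥0 | (z : ℝ) ≤ s} :=
    measurableSet_le measurable_coe_nnreal_real measurable_const
  change (ENNReal.ofReal y₀ • Measure.dirac 0 + ENNReal.ofReal (y₁ - y₀) • Measure.dirac a +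
    ENNReal.ofReal (1 - y₁) • Measure.dirac (a + b)).real {z : ℝ≥0 | (z : ℝ) ≤ s} = _
  have hb : (0 : ℝ) ≤ b := b.2
  rw [measureReal_def]
  simp only [Measure.add_apply, Measure.smul_apply, smul_eq_mul, Measure.dirac_apply' _ hm]
  split_ifs with h1 h2
  · have h2 : s < (a : ℝ) + b := by linarith
    simp [indicator, hs, h1.not_ge, h2.not_ge, hy₀]
  · rw [not_lt] at h1
    simp only [indicator, mem_ofPred_eq, NNReal.coe_zero, NNReal.coe_add, hs, h1, h2.not_ge, if_true,
      if_false, Pi.one_apply, mul_one, mul_zero, add_zero]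
    rw [← ENNReal.ofReal_add hy₀ (by linarith), ENNReal.toReal_ofReal (by linarith)]
    ring
  · rw [not_lt] at h1 h2
    simp only [indicator, mem_ofPred_eq, NNReal.coe_zero, NNReal.coe_add, hs, h1, h2, if_true,
      Pi.one_apply, mul_one]
    rw [← ENNReal.ofReal_add hy₀ (by linarith), ← ENNReal.ofReal_add (by linarith) (by linarith),
      ENNReal.toReal_ofReal (by linarith)]
    ring

/-- The distribution function equals `y₀` on a stretch of length `a`, then `y₁` on one of length
`b`, then `1`; the condition at `1` removes the infinite tail. The lengths serve as nature's weights
on the two levels. -/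
lemma integral_comp_realCdf_threePoint (φ : ℝ → ℝ) (hφ : φ 1 = 0) :
    ∫ s in Ioi (0 : ℝ), φ (realCdf (threePoint y₀ y₁ hy₀ hy hy₁ a b) s) = a * φ y₀ + b * φ y₁ := by
  have ha : (0 : ℝ) ≤ a := a.2
  have hb : (0 : ℝ) ≤ b := b.2
  have h : EqOn (fun s => φ (realCdf (threePoint y₀ y₁ hy₀ hy hy₁ a b) s))
      (fun s => (Iio (a : ℝ)).indicator (fun _ => φ y₀) s +
        (Ico (a : ℝ) (a + b)).indicator (fun _ => φ y₁) s) (Ici 0) := by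
    intro s hs
    simp only
    rw [realCdf_threePoint hs]
    split_ifs with h1 h2
    · simp [indicator, h1, h1.not_ge]
    · rw [not_lt] at h1
      simp [indicator, h1, h2]
    · rw [not_lt] at h1 h2
      simp [indicator, h1.not_gt, h2.not_gt, hφ]
  rw [← integral_Ici_eq_integral_Ioi, setIntegral_congr_fun measurableSet_Ici h, integral_add,
    integral_indicator measurableSet_Iio, integral_indicator measurableSet_Ico,
    Measure.restrict_restrict measurableSet_Iio, Measure.restrict_restrict measurableSet_Ico,
    inter_comm, Ici_inter_Iio,
    inter_eq_left.mpr (Ico_subset_Ici_self.trans (Ici_subset_Ici.mpr ha)),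
    setIntegral_const, setIntegral_const]
  · simp [ha, hb]
  · rw [integrable_indicator_iff measurableSet_Iio, IntegrableOn,
      Measure.restrict_restrict measurableSet_Iio, inter_comm, Ici_inter_Iio]
    exact integrableOn_const (by simp)
  · exact ((integrable_indicator_iff measurableSet_Ico).mpr (integrableOn_const (by simp))).restrict

end ThreePoint

/-! ### Minimax from a maximin strategy -/

/-- The chain `v ≤ sup inf ≤ inf sup ≤ v` closes: the first step comes from `a₀`, the second is weak
duality, the third is `h₂`. The upper bound is asked of the infimum itself, so nature needs no
optimal strategy. -/
lemma iInf_iSup_eq_of_maximin {α β L : Type*} [CompleteLattice L] (K : α → β → L) (s : Set β)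
    {v : L} (a₀ : α) (h₁ : ∀ b ∈ s, v ≤ K a₀ b) (h₂ : (⨅ b ∈ s, ⨆ a, K a b) ≤ v) :
    (⨅ b ∈ s, ⨆ a, K a b) = v ∧ (⨆ a, ⨅ b ∈ s, K a b) = v := by
  have h₃ : v ≤ ⨆ a, ⨅ b ∈ s, K a b := le_iSup_of_le a₀ (le_iInf₂ h₁)
  have h₄ : (⨆ a, ⨅ b ∈ s, K a b) ≤ ⨅ b ∈ s, ⨆ a, K a b :=
    iSup_le fun a => iInf₂_mono fun b _ => le_iSup (fun a => K a b) a
  exact ⟨le_antisymm h₂ (h₃.trans h₄), le_antisymm (h₄.trans h₂) h₃⟩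

lemma iSup_iInf_eq_of_minimax {α β L : Type*} [CompleteLattice L] (K : α → β → L) (s : Set β)
    {v : L} (a₀ : α) (h₁ : ∀ b ∈ s, K a₀ b ≤ v) (h₂ : v ≤ ⨆ b ∈ s, ⨅ a, K a b) :
    (⨆ b ∈ s, ⨅ a, K a b) = v ∧ (⨅ a, ⨆ b ∈ s, K a b) = v :=
  iInf_iSup_eq_of_maximin (L := Lᵒᵈ) K s a₀ h₁ h₂

lemma iInf_iSup_eq_of_saddle {α β : Type*} (K : α → β → ℝ) {v : ℝ} (a₀ : α) (b₀ : β)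
    (h₁ : ∀ b, v ≤ K a₀ b) (h₂ : ∀ a, K a b₀ ≤ v) :
    (⨅ b, ⨆ a, (K a b : EReal)) = v ∧ (⨆ a, ⨅ b, (K a b : EReal)) = v := by
  simpa using iInf_iSup_eq_of_maximin (fun a b => (K a b : EReal)) univ a₀
    (fun b _ => EReal.coe_le_coe (h₁ b))
    (iInf₂_le_of_le b₀ (mem_univ _) (iSup_le fun a => EReal.coe_le_coe (h₂ a)))

lemma iSup_iInf_eq_of_saddle {α β : Type*} (K : α → β → ℝ) {v : ℝ} (a₀ : α) (b₀ : β)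
    (h₁ : ∀ b, K a₀ b ≤ v) (h₂ : ∀ a, v ≤ K a b₀) :
    (⨆ b, ⨅ a, (K a b : EReal)) = v ∧ (⨅ a, ⨆ b, (K a b : EReal)) = v := by
  simpa using iSup_iInf_eq_of_minimax (fun a b => (K a b : EReal)) univ a₀
    (fun b _ => EReal.coe_le_coe (h₁ b))
    (le_iSup₂_of_le b₀ (mem_univ _) (le_iInf fun a => EReal.coe_le_coe (h₂ a)))

/-! ### Mixed strategies -/

/-- The mixed strategy which plays `a` with probability `p` and `b` with probability `1 - p`. -/
def twoPoint (p a b : I) : ProbabilityMeasure I :=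
  ⟨bernoulliMeasure a b p, inferInstance⟩

lemma integral_twoPoint (p a b : I) (f : I → ℝ) :
    ∫ y, f y ∂(twoPoint p a b : Measure I) = p * f a + (1 - p) * f b := by
  change ∫ y, f y ∂(bernoulliMeasure a b p) = _
  rw [integral_bernoulliMeasure]
  simp

lemma integral_diracProba (a : I) (f : I → ℝ) :
    ∫ x, f x ∂(diracProba a : Measure I) = f a :=
  integral_dirac f a

lemma le_integral_of_forall_le {f : I → ℝ} (lam : ProbabilityMeasure I) {c : ℝ}
    (hf : Integrable f (lam : Measure I)) (h : ∀ x, c ≤ f x) : c ≤ ∫ x, f x ∂(lam : Measure I) := by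
  simpa using integral_mono (integrable_const c) hf h

lemma integral_le_of_forall_le {f : I → ℝ} (lam : ProbabilityMeasure I) {c : ℝ}
    (hf : Integrable f (lam : Measure I)) (h : ∀ x, f x ≤ c) : ∫ x, f x ∂(lam : Measure I) ≤ c := by
  simpa using integral_mono hf (integrable_const c) h

/-- For `n ≥ 2` the kernel `R` jumps at `(1, 1)`, since `R(1, y)` tends to `1 / n` as `y` increases
to `1`; integrability therefore rests on measurability and boundedness. -/
lemma measurable_kernelR (n : ℕ) : Measurable fun q : ℝ × ℝ => kernelR n q.1 q.2 := by
  refine Measurable.ite (measurableSet_lt measurable_snd measurable_fst) (by fun_prop)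
    (Measurable.ite (measurableSet_lt measurable_fst measurable_snd) (by fun_prop) (by fun_prop))

lemma integrable_kernelR_left (n : ℕ) [NeZero n] (lam : ProbabilityMeasure I) (y : I) :
    Integrable (fun x : I => kernelR n x y) (lam : Measure I) := by
  have hm : Measurable fun x : I => kernelR n x y :=
    (measurable_kernelR n).comp (measurable_subtype_coe.prodMk measurable_const)
  refine (integrable_const (1 : ℝ)).mono' hm.aestronglyMeasurable (.of_forall fun x => ?_)
  rw [Real.norm_of_nonneg (kernelR_nonneg n x.2.1 x.2.2 y.2.1 y.2.2)]
  exact kernelR_le_one n x.2.1 x.2.2 y.2.1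

lemma integrable_kernelR_right (n : ℕ) [NeZero n] (mu : ProbabilityMeasure I) (x : I) :
    Integrable (fun y : I => kernelR n x y) (mu : Measure I) := by
  have hm : Measurable fun y : I => kernelR n x y :=
    (measurable_kernelR n).comp (measurable_const.prodMk measurable_subtype_coe)
  refine (integrable_const (1 : ℝ)).mono' hm.aestronglyMeasurable (.of_forall fun y => ?_)
  rw [Real.norm_of_nonneg (kernelR_nonneg n x.2.1 x.2.2 y.2.1 y.2.2)]
  exact kernelR_le_one n x.2.1 x.2.2 y.2.1

lemma continuous_kernelA (n : ℕ) [NeZero n] : Continuous fun q : ℝ × ℝ => kernelA n q.1 q.2 := by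
  simp_rw [← one_sub_pow_sub_levelReward n, levelReward]
  fun_prop

lemma integrable_of_continuous {f : I → ℝ} (hf : Continuous f) (lam : ProbabilityMeasure I) :
    Integrable f (lam : Measure I) :=
  hf.integrable_of_hasCompactSupport (HasCompactSupport.of_compactSpace f)

lemma integrable_kernelA_left (n : ℕ) [NeZero n] (lam : ProbabilityMeasure I) (y : I) :
    Integrable (fun x : I => kernelA n x y) (lam : Measure I) :=
  integrable_of_continuous
    ((continuous_kernelA n).comp (continuous_subtype_val.prodMk continuous_const)) lam

lemma integrable_kernelA_right (n : ℕ) [NeZero n] (mu : ProbabilityMeasure I) (x : I) :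
    Integrable (fun y : I => kernelA n x y) (mu : Measure I) :=
  integrable_of_continuous
    ((continuous_kernelA n).comp (continuous_const.prodMk continuous_subtype_val)) mu

lemma realCdf_eq_one_of_ae {F : ProbabilityMeasure ℝ≥0} {s : ℝ}
    (h : ∀ᵐ z : ℝ≥0 ∂(F : Measure ℝ≥0), (z : ℝ) ≤ s) : realCdf F s = 1 := by
  have hm : MeasurableSet {z : ℝ≥0 | (z : ℝ) ≤ s} :=
    measurableSet_le measurable_coe_nnreal_real measurable_const
  rw [realCdf, measureReal_def, (mem_ae_iff_prob_eq_one hm).mp h, ENNReal.toReal_one]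

/-! ### Bounds for the ratio -/

lemma prophet_pos (n : ℕ) [NeZero n] {F : ProbabilityMeasure ℝ≥0} (hF : F ∈ distNonneg) :
    0 < prophet n F := by
  obtain ⟨hint, hne⟩ := hF
  have h1 : 0 < ∫ x : ℝ≥0, (x : ℝ) ∂(F : Measure ℝ≥0) := by
    refine lt_of_le_of_ne (integral_nonneg fun x => x.2) fun h => hne ?_
    filter_upwards [(integral_eq_zero_iff_of_nonneg (fun x : ℝ≥0 => x.2) hint).mp h.symm] with x hx
    exact NNReal.coe_eq_zero.mp hx
  refine h1.trans_le ?_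
  rw [prophet_eq_integral n hint, hint.integral_eq_integral_meas_lt (.of_forall fun x => x.2)]
  simp_rw [measureReal_lt_coe]
  refine integral_mono (integrableOn_one_sub_realCdf hint) (integrableOn_one_sub_pow n hint)
    fun s => ?_
  have := pow_le_of_le_one (realCdf_nonneg F s) (realCdf_le_one F s) (NeZero.ne n)
  simp only
  linarith

lemma le_ratio (n : ℕ) [NeZero n] (τ : ThresholdRule) {F : ProbabilityMeasure ℝ≥0}
    (hF : F ∈ distNonneg) {v : ℝ}
    (hv : ∀ y, 0 ≤ y → y ≤ 1 → v ≤ kernelR n (rejectProb τ F) y) : v ≤ ratio n τ F := by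
  rw [ratio, le_div_iff₀ (prophet_pos n hF), prophet_eq_integral n hF.1,
    reward_eq_integral n τ hF.1, ← integral_const_mul]
  refine integral_mono ((integrableOn_one_sub_pow n hF.1).const_mul v)
    (integrableOn_levelReward n hF.1 (rejectProb_le_one τ F)) fun s => ?_
  have hy := realCdf_nonneg F s
  have hy1 := realCdf_le_one F s
  simp only
  rw [← kernelR_mul_one_sub_pow n (rejectProb_nonneg τ F) (rejectProb_le_one τ F) hy]
  exact mul_le_mul_of_nonneg_right (hv _ hy hy1) (sub_nonneg.mpr (pow_le_one₀ hy hy1))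

lemma mixedRatio_diracProba (n : ℕ) [NeZero n] (x : I) (F : ProbabilityMeasure ℝ≥0) :
    mixedRatio n (diracProba x) F = ratio n (levelRule x F) F :=
  integral_diracProba x _

lemma mixedRatio_le (n : ℕ) [NeZero n] (lam : ProbabilityMeasure I) {F : ProbabilityMeasure ℝ≥0}
    {c : ℝ} (hc : 0 ≤ c) (h : ∀ τ, ratio n τ F ≤ c) : mixedRatio n lam F ≤ c := by
  by_cases hint : Integrable (fun x => ratio n (levelRule x F) F) (lam : Measure I)
  · exact integral_le_of_forall_le lam hint fun x => h _
  -- A non-integrable ratio would have integral `0` by convention; `0 ≤ c` covers this case, so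
  -- measurability in the level need not be proved.
  · rw [mixedRatio, integral_undef hint]
    exact hc

/-- A two-point mixed strategy of nature on the levels `y₀ < 1` and `1` which concedes at most `v`
is approximated by distributions for which no threshold rule has a ratio much larger than `v`. -/
lemma exists_distNonneg_ratio_le (n : ℕ) [NeZero n] {y₀ p v : ℝ} (hy₀ : 0 ≤ y₀) (hy₀1 : y₀ < 1)
    (hp : 0 ≤ p) (hp1 : p ≤ 1)
    (hv : ∀ x, 0 ≤ x → x ≤ 1 → p * kernelR n x y₀ + (1 - p) * kernelR n x 1 ≤ v)
    {c : ℝ} (hc : v < c) : ∃ F ∈ distNonneg, ∀ τ, ratio n τ F ≤ c := by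
  have hn := NeZero.ne n
  have hn0 : (n : ℝ) ≠ 0 := Nat.cast_ne_zero.mpr hn
  have hlim : Filter.Tendsto (fun y : ℝ => n / (∑ k ∈ Finset.range n, y ^ k) * v)
      (nhdsWithin 1 (Iio 1)) (nhds v) := by
    have h1 : ContinuousAt (fun y : ℝ => n / (∑ k ∈ Finset.range n, y ^ k) * v) 1 := by
      refine (continuousAt_const.div (by fun_prop) ?_).mul continuousAt_const
      simp [hn0]
    have h2 := h1.tendsto
    simp only [one_pow, Finset.sum_const, Finset.card_range, nsmul_eq_mul, mul_one, div_self hn0,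
      one_mul] at h2
    exact h2.mono_left nhdsWithin_le_nhds
  obtain ⟨y₁, hy₁c, hy₀₁, hy₁⟩ := ((hlim.eventually_lt_const hc).and
    ((eventually_nhdsWithin_of_eventually_nhds (lt_mem_nhds hy₀1)).and
      self_mem_nhdsWithin)).exists
  replace hy₁ : y₁ < 1 := hy₁
  have hy₁0 : 0 ≤ y₁ := hy₀.trans hy₀₁.le
  have hD₀ : 0 < 1 - y₀ ^ n := sub_pos.mpr (pow_lt_one₀ hy₀ hy₀1 hn)
  have hD₁ : 0 < 1 - y₁ ^ n := sub_pos.mpr (pow_lt_one₀ hy₁0 hy₁ hn)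
  -- Dividing by `1 - y ^ n` offsets the weight of each level in the ratio: the levels get weights
  -- `p` and `1 - p`, and the prophet's value becomes `1`.
  let a : ℝ≥0 := ⟨p / (1 - y₀ ^ n), div_nonneg hp hD₀.le⟩
  let b : ℝ≥0 := ⟨(1 - p) / (1 - y₁ ^ n), div_nonneg (sub_nonneg.mpr hp1) hD₁.le⟩
  have ha : (a : ℝ) * (1 - y₀ ^ n) = p := div_mul_cancel₀ _ hD₀.ne'
  have hb : (b : ℝ) * (1 - y₁ ^ n) = 1 - p := div_mul_cancel₀ _ hD₁.ne'
  set F := threePoint y₀ y₁ hy₀ hy₀₁.le hy₁.le a b with hFdef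
  have hint : Integrable (fun x : ℝ≥0 => (x : ℝ)) (F : Measure ℝ≥0) := integrable_threePoint
  have hM : prophet n F = 1 := by
    rw [prophet_eq_integral n hint, hFdef,
      integral_comp_realCdf_threePoint (fun y => 1 - y ^ n) (by simp)]
    simp only [ha, hb]
    ring
  refine ⟨F, ⟨hint, fun h0 => ?_⟩, fun τ => ?_⟩
  · have h1 : ∀ s ∈ Ioi (0 : ℝ), 1 - realCdf F s ^ n = 0 := fun s hs => by
      have h2 : ∀ᵐ z : ℝ≥0 ∂(F : Measure ℝ≥0), (z : ℝ) ≤ s := by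
        filter_upwards [h0] with z hz
        simpa [hz] using le_of_lt hs
      rw [realCdf_eq_one_of_ae h2]; simp
    rw [prophet_eq_integral n hint, setIntegral_congr_fun measurableSet_Ioi h1] at hM
    simp at hM
  · set x := rejectProb τ F with hx
    have hx0 : 0 ≤ x := rejectProb_nonneg τ F
    have hx1 : x ≤ 1 := rejectProb_le_one τ F
    have hSy := geom_sum_pos_of_nonneg hn hy₁0
    have hfac : 1 ≤ n / (∑ k ∈ Finset.range n, y₁ ^ k) :=
      (one_le_div hSy).mpr (geom_sum_le hy₁0 hy₁.le)
    rw [ratio, hM, div_one, reward_eq_integral n τ hint, ← hx, hFdef,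
      integral_comp_realCdf_threePoint (levelReward n x) (by simp [levelReward_eq_of_ge n hx1]),
      ← kernelR_mul_one_sub_pow n hx0 hx1 hy₀, ← kernelR_mul_one_sub_pow n hx0 hx1 hy₁0]
    calc (a : ℝ) * (kernelR n x y₀ * (1 - y₀ ^ n)) + b * (kernelR n x y₁ * (1 - y₁ ^ n))
        = p * (1 * kernelR n x y₀) + (1 - p) * kernelR n x y₁ := by
          rw [← hb, ← ha]; ring
      _ ≤ p * (n / (∑ k ∈ Finset.range n, y₁ ^ k) * kernelR n x y₀)
          + (1 - p) * (n / (∑ k ∈ Finset.range n, y₁ ^ k) * kernelR n x 1) := by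
          refine add_le_add (mul_le_mul_of_nonneg_left (mul_le_mul_of_nonneg_right hfac ?_) hp)
            (mul_le_mul_of_nonneg_left ?_ (sub_nonneg.mpr hp1))
          · exact kernelR_nonneg n hx0 hx1 hy₀ hy₀1.le
          · exact kernelR_le_mul_kernelR_one n hx0 hx1 hy₁0
      _ = n / (∑ k ∈ Finset.range n, y₁ ^ k) * (p * kernelR n x y₀ + (1 - p) * kernelR n x 1) := by
          ring
      _ ≤ n / (∑ k ∈ Finset.range n, y₁ ^ k) * v :=
          mul_le_mul_of_nonneg_left (hv x hx0 hx1) (zero_le_one.trans hfac)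
      _ ≤ c := hy₁c.le

/-! ### Bounds for the regret -/

lemma integrable_of_mem_distUnit {F : ProbabilityMeasure ℝ≥0} (hF : F ∈ distUnit) :
    Integrable (fun x : ℝ≥0 => (x : ℝ)) (F : Measure ℝ≥0) := by
  refine (integrable_const (1 : ℝ)).mono' measurable_coe_nnreal_real.aestronglyMeasurable ?_
  filter_upwards [hF] with x hx
  rw [Real.norm_of_nonneg (NNReal.coe_nonneg x)]
  exact_mod_cast hx

lemma realCdf_eq_one_of_mem_distUnit {F : ProbabilityMeasure ℝ≥0} (hF : F ∈ distUnit) {s : ℝ}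
    (hs : 1 ≤ s) : realCdf F s = 1 := by
  refine realCdf_eq_one_of_ae ?_
  filter_upwards [hF] with z hz
  exact (NNReal.coe_le_one.mpr hz).trans hs

/-- The integrand vanishes for `s ≥ 1`, where `F(s) = 1` and `A(x, 1) = 0`, so the regret is an
average of `A(x, F(s))` over the unit interval. -/
lemma regret_le (n : ℕ) [NeZero n] (τ : ThresholdRule) {F : ProbabilityMeasure ℝ≥0}
    (hF : F ∈ distUnit) {w : ℝ}
    (hw : ∀ y, 0 ≤ y → y ≤ 1 → kernelA n (rejectProb τ F) y ≤ w) : regret n τ F ≤ w := by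
  have hint := integrable_of_mem_distUnit hF
  have h1 : IntegrableOn (fun s => kernelA n (rejectProb τ F) (realCdf F s)) (Ioi 0) := by
    simp_rw [← one_sub_pow_sub_levelReward n]
    exact (integrableOn_one_sub_pow n hint).sub
      (integrableOn_levelReward n hint (rejectProb_le_one τ F))
  have h2 : IntegrableOn ((Iio (1 : ℝ)).indicator fun _ => w) (Ioi 0) := by
    rw [IntegrableOn, integrable_indicator_iff measurableSet_Iio, IntegrableOn,
      Measure.restrict_restrict measurableSet_Iio, inter_comm, Ioi_inter_Iio]
    exact integrableOn_const (by simp)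
  calc regret n τ F ≤ ∫ s in Ioi (0 : ℝ), (Iio (1 : ℝ)).indicator (fun _ => w) s := by
        rw [regret_eq_integral n τ hint]
        refine integral_mono h1 h2 fun s => ?_
        rcases lt_or_ge s 1 with hs | hs
        · simpa [hs] using hw _ (realCdf_nonneg F s) (realCdf_le_one F s)
        · obtain ⟨m, rfl⟩ : ∃ m, n = m + 1 := ⟨n - 1, by have := NeZero.ne n; omega⟩
          simp [hs.not_gt, realCdf_eq_one_of_mem_distUnit hF hs,
            kernelA_eq_of_ge m (rejectProb_le_one τ F)]
    _ = w := by
        rw [integral_indicator measurableSet_Iio, Measure.restrict_restrict measurableSet_Iio,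
          inter_comm, Ioi_inter_Iio]
        simp

/-- A two-point mixed strategy of nature in the regret game is realized by a three-point
distribution. -/
lemma exists_distUnit_regret_eq (n : ℕ) [NeZero n] {y₁ y₂ p : ℝ} (hy₁ : 0 ≤ y₁) (hy : y₁ ≤ y₂)
    (hy₂ : y₂ ≤ 1) (hp : 0 ≤ p) (hp1 : p ≤ 1) :
    ∃ F ∈ distUnit, ∀ τ, regret n τ F =
      p * kernelA n (rejectProb τ F) y₁ + (1 - p) * kernelA n (rejectProb τ F) y₂ := by
  let a : ℝ≥0 := ⟨p, hp⟩
  let b : ℝ≥0 := ⟨1 - p, sub_nonneg.mpr hp1⟩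
  have hab : a + b = 1 := NNReal.eq (add_sub_cancel p 1)
  refine ⟨threePoint y₁ y₂ hy₁ hy hy₂ a b, ae_threePoint zero_le_one ?_ hab.le, fun τ => ?_⟩
  · exact hab ▸ le_self_add
  · have hA : kernelA n (rejectProb τ (threePoint y₁ y₂ hy₁ hy hy₂ a b)) 1 = 0 := by
      rw [← one_sub_pow_sub_levelReward, levelReward_eq_of_ge n (rejectProb_le_one _ _)]
      simp
    rw [regret_eq_integral n τ integrable_threePoint,
      integral_comp_realCdf_threePoint (kernelA n _) hA]
    rfl

/-! ### The two games -/

theorem ratio_game (n : ℕ) [NeZero n] :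
    ∃ v : ℝ,
      (∃ lam₀ mu₀ : ProbabilityMeasure I, payoffR n lam₀ mu₀ = v ∧
        (∀ lam, payoffR n lam mu₀ ≤ v) ∧ (∀ mu, v ≤ payoffR n lam₀ mu)) ∧
      (⨅ mu, ⨆ lam, (payoffR n lam mu : EReal)) = v ∧
      (⨆ lam, ⨅ mu, (payoffR n lam mu : EReal)) = v ∧
      (⨅ F ∈ distNonneg, ⨆ τ ∈ finiteRules, (ratio n τ F : EReal)) = v ∧
      (⨅ F ∈ distNonneg, ⨆ x : I, (ratio n (levelRule x F) F : EReal)) = v ∧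
      (⨆ x : I, ⨅ F ∈ distNonneg, (ratio n (levelRule x F) F : EReal)) = v ∧
      (⨅ F ∈ distNonneg, ⨆ lam, (mixedRatio n lam F : EReal)) = v ∧
      (⨆ lam, ⨅ F ∈ distNonneg, (mixedRatio n lam F : EReal)) = v := by
  obtain ⟨x₀, y₀, p, v, hx₀, hx₀1, hy₀, hy₀1, hp, hp1, hv0, hlow, hup⟩ := exists_ratio_solution n
  let X₀ : I := ⟨x₀, hx₀, hx₀1.le⟩
  let mu₀ : ProbabilityMeasure I := twoPoint ⟨p, hp, hp1⟩ ⟨y₀, hy₀, hy₀1.le⟩ 1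
  have hmu : ∀ lam, payoffR n lam mu₀ ≤ v := fun lam => by
    rw [payoffR, integral_twoPoint, ← integral_const_mul, ← integral_const_mul, ← integral_add
      ((integrable_kernelR_left n lam _).const_mul _)
      ((integrable_kernelR_left n lam _).const_mul _)]
    exact integral_le_of_forall_le lam (((integrable_kernelR_left n lam _).const_mul _).add
      ((integrable_kernelR_left n lam _).const_mul _)) fun x => hup x x.2.1 x.2.2
  have hlam : ∀ mu, v ≤ payoffR n (diracProba X₀) mu := fun mu => by
    simp_rw [payoffR, integral_diracProba]
    exact le_integral_of_forall_le mu (integrable_kernelR_right n mu X₀)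
      fun y => hlow y y.2.1 y.2.2
  have hpure : ∀ F ∈ distNonneg, v ≤ ratio n (levelRule X₀ F) F := fun F hF =>
    le_ratio n _ hF (by rw [rejectProb_levelRule]; exact hlow)
  have hnear : ∀ c : ℝ, v < c → ∃ F ∈ distNonneg, ∀ τ, ratio n τ F ≤ c := fun c hc =>
    exists_distNonneg_ratio_le n hy₀ hy₀1 hp hp1 hup hc
  have h₁ := iInf_iSup_eq_of_saddle (payoffR n) (diracProba X₀) mu₀ hlam hmu
  have h₂ := iInf_iSup_eq_of_maximin
    (fun (x : I) F => (ratio n (levelRule x F) F : EReal)) distNonneg X₀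
    (fun F hF => EReal.coe_le_coe (hpure F hF))
    (EReal.le_of_forall_lt_iff_le.mp fun c hc => by
      obtain ⟨F, hF, h⟩ := hnear c (EReal.coe_lt_coe_iff.mp hc)
      exact iInf₂_le_of_le F hF (iSup_le fun x => EReal.coe_le_coe (h _)))
  have h₃ := iInf_iSup_eq_of_maximin
    (fun lam F => (mixedRatio n lam F : EReal)) distNonneg (diracProba X₀)
    (fun F hF => EReal.coe_le_coe ((hpure F hF).trans_eq (mixedRatio_diracProba n X₀ F).symm))
    (EReal.le_of_forall_lt_iff_le.mp fun c hc => by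
      have hc := EReal.coe_lt_coe_iff.mp hc
      obtain ⟨F, hF, h⟩ := hnear c hc
      exact iInf₂_le_of_le F hF
        (iSup_le fun lam => EReal.coe_le_coe (mixedRatio_le n lam (hv0.trans hc.le) h)))
  refine ⟨v, ⟨diracProba X₀, mu₀, le_antisymm (hmu _) (hlam _), hmu, hlam⟩, h₁.1, h₁.2,
    le_antisymm ?_ ?_, h₂.1, h₂.2, h₃.1, h₃.2⟩
  · refine EReal.le_of_forall_lt_iff_le.mp fun c hc => ?_
    obtain ⟨F, hF, h⟩ := hnear c (EReal.coe_lt_coe_iff.mp hc)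
    exact iInf₂_le_of_le F hF (iSup₂_le fun τ _ => EReal.coe_le_coe (h τ))
  · refine le_iInf₂ fun F hF => le_iSup₂_of_le (levelRule X₀ F) ?_ (EReal.coe_le_coe (hpure F hF))
    -- The strict bound `x₀ < 1` keeps the threshold finite even when `F` has unbounded support.
    obtain ⟨z, hz⟩ := exists_le_realCdf F hx₀1
    exact quantile_ne_top F hz

theorem regret_game (n : ℕ) [NeZero n] :
    ∃ v : ℝ,
      (∃ lam₀ mu₀ : ProbabilityMeasure I, payoffA n lam₀ mu₀ = v ∧
        (∀ lam, v ≤ payoffA n lam mu₀) ∧ (∀ mu, payoffA n lam₀ mu ≤ v)) ∧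
      (⨆ mu, ⨅ lam, (payoffA n lam mu : EReal)) = v ∧
      (⨅ lam, ⨆ mu, (payoffA n lam mu : EReal)) = v ∧
      (⨆ F ∈ distUnit, ⨅ τ ∈ finiteRules, (regret n τ F : EReal)) = v ∧
      (⨆ F ∈ distUnit, ⨅ x : I, (regret n (levelRule x F) F : EReal)) = v ∧
      (⨅ x : I, ⨆ F ∈ distUnit, (regret n (levelRule x F) F : EReal)) = v ∧
      (⨆ F ∈ distUnit, ⨅ lam, (mixedRegret n lam F : EReal)) = v ∧
      (⨅ lam, ⨆ F ∈ distUnit, (mixedRegret n lam F : EReal)) = v := by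
  obtain ⟨x₀, y₁, y₂, p, w, hx₀, hx₀1, hy₁, hy, hy₂, hp, hp1, hup, hlow⟩ :=
    exists_regret_solution n
  let X₀ : I := ⟨x₀, hx₀, hx₀1⟩
  let Y₁ : I := ⟨y₁, hy₁, hy.trans hy₂⟩
  let Y₂ : I := ⟨y₂, hy₁.trans hy, hy₂⟩
  let mu₀ : ProbabilityMeasure I := twoPoint ⟨p, hp, hp1⟩ Y₁ Y₂
  have hmix : ∀ lam : ProbabilityMeasure I,
      w ≤ ∫ x : I, (p * kernelA n x Y₁ + (1 - p) * kernelA n x Y₂) ∂(lam : Measure I) := fun lam =>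
    le_integral_of_forall_le lam (((integrable_kernelA_left n lam Y₁).const_mul p).add
      ((integrable_kernelA_left n lam Y₂).const_mul (1 - p))) fun x => hlow x x.2.1 x.2.2
  have hmu : ∀ lam, w ≤ payoffA n lam mu₀ := fun lam => by
    rw [payoffA, integral_twoPoint, ← integral_const_mul, ← integral_const_mul, ← integral_add
      ((integrable_kernelA_left n lam _).const_mul _)
      ((integrable_kernelA_left n lam _).const_mul _)]
    exact hmix lam
  have hlam : ∀ mu, payoffA n (diracProba X₀) mu ≤ w := fun mu => by
    simp_rw [payoffA, integral_diracProba]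
    exact integral_le_of_forall_le mu (integrable_kernelA_right n mu X₀)
      fun y => hup y y.2.1 y.2.2
  have hpure : ∀ F ∈ distUnit, regret n (levelRule X₀ F) F ≤ w := fun F hF =>
    regret_le n _ hF (by rw [rejectProb_levelRule]; exact hup)
  obtain ⟨F₀, hF₀, hregret⟩ := exists_distUnit_regret_eq n hy₁ hy hy₂ hp hp1
  have hall : ∀ τ, w ≤ regret n τ F₀ := fun τ =>
    (hlow _ (rejectProb_nonneg τ F₀) (rejectProb_le_one τ F₀)).trans_eq (hregret τ).symm
  have hmixed : ∀ lam, w ≤ mixedRegret n lam F₀ := fun lam => by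
    -- Under `F₀` the regret is an explicit continuous function of the level, so the mixed regret is
    -- a genuine integral.
    simp_rw [mixedRegret, hregret, rejectProb_levelRule]
    exact hmix lam
  have hdirac : ∀ F, mixedRegret n (diracProba X₀) F = regret n (levelRule X₀ F) F := fun F =>
    integral_diracProba X₀ _
  have h₁ := iSup_iInf_eq_of_saddle (payoffA n) (diracProba X₀) mu₀ hlam hmu
  have h₂ := iSup_iInf_eq_of_minimax
    (fun (x : I) F => (regret n (levelRule x F) F : EReal)) distUnit X₀
    (fun F hF => EReal.coe_le_coe (hpure F hF))
    (le_iSup₂_of_le F₀ hF₀ (le_iInf fun x => EReal.coe_le_coe (hall _)))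
  have h₃ := iSup_iInf_eq_of_minimax
    (fun lam F => (mixedRegret n lam F : EReal)) distUnit (diracProba X₀)
    (fun F hF => EReal.coe_le_coe ((hdirac F).trans_le (hpure F hF)))
    (le_iSup₂_of_le F₀ hF₀ (le_iInf fun lam => EReal.coe_le_coe (hmixed lam)))
  refine ⟨w, ⟨diracProba X₀, mu₀, le_antisymm (hlam _) (hmu _), hmu, hlam⟩, h₁.1, h₁.2,
    le_antisymm ?_ ?_, h₂.1, h₂.2, h₃.1, h₃.2⟩
  · refine iSup₂_le fun F hF => iInf₂_le_of_le (levelRule X₀ F) ?_ (EReal.coe_le_coe (hpure F hF))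
    -- On `[0, 1]` one has `F(1) = 1`, so every level, including `1`, has a finite threshold.
    exact quantile_ne_top F (z := 1)
      (hx₀1.trans_eq (realCdf_eq_one_of_mem_distUnit hF le_rfl).symm)
  · exact le_iSup₂_of_le F₀ hF₀ (le_iInf₂ fun τ _ => EReal.coe_le_coe (hall τ))

end ProphetGame

end

open ProphetGame in
theorem corollary3 (n : ℕ) [NeZero n] :
    (∃ v : ℝ,
      (∃ lam₀ mu₀ : ProbabilityMeasure I, payoffR n lam₀ mu₀ = v ∧
        (∀ lam, payoffR n lam mu₀ ≤ v) ∧ (∀ mu, v ≤ payoffR n lam₀ mu)) ∧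
      (⨅ mu, ⨆ lam, (payoffR n lam mu : EReal)) = v ∧
      (⨆ lam, ⨅ mu, (payoffR n lam mu : EReal)) = v ∧
      (⨅ F ∈ distNonneg, ⨆ τ ∈ finiteRules, (ratio n τ F : EReal)) = v ∧
      (⨅ F ∈ distNonneg, ⨆ x : I, (ratio n (levelRule x F) F : EReal)) = v ∧
      (⨆ x : I, ⨅ F ∈ distNonneg, (ratio n (levelRule x F) F : EReal)) = v ∧
      (⨅ F ∈ distNonneg, ⨆ lam, (mixedRatio n lam F : EReal)) = v ∧
      (⨆ lam, ⨅ F ∈ distNonneg, (mixedRatio n lam F : EReal)) = v) ∧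
    (∃ v : ℝ,
      (∃ lam₀ mu₀ : ProbabilityMeasure I, payoffA n lam₀ mu₀ = v ∧
        (∀ lam, v ≤ payoffA n lam mu₀) ∧ (∀ mu, payoffA n lam₀ mu ≤ v)) ∧
      (⨆ mu, ⨅ lam, (payoffA n lam mu : EReal)) = v ∧
      (⨅ lam, ⨆ mu, (payoffA n lam mu : EReal)) = v ∧
      (⨆ F ∈ distUnit, ⨅ τ ∈ finiteRules, (regret n τ F : EReal)) = v ∧
      (⨆ F ∈ distUnit, ⨅ x : I, (regret n (levelRule x F) F : EReal)) = v ∧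
      (⨅ x : I, ⨆ F ∈ distUnit, (regret n (levelRule x F) F : EReal)) = v ∧
      (⨆ F ∈ distUnit, ⨅ lam, (mixedRegret n lam F : EReal)) = v ∧
      (⨅ lam, ⨆ F ∈ distUnit, (mixedRegret n lam F : EReal)) = v) :=
  ⟨ratio_game n, regret_game n⟩
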